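/- Let $\tau\in\mathbb H$, $E_\tau=\mathbb C/(\mathbb Z\oplus\mathbb Z\tau)$, let $\alpha_1,\dots,\alpha_n>-1$ be real numbers with $\sum_i\alpha_i=0$, and let $z=(z_1,\dots,z_n)\in\mathbb C^n$ be such that the classes $[z_1],\dots,[z_n]\in E_\tau$ are pairwise distinct. Let $$\theta(u,\tau)=-i\sum_{k\in\mathbb Z}(-1)^k\exp\Big(i\pi\big(k+\tfrac12\big)^2\tau+2i\pi\big(k+\tfrac12\big)u\Big),\qquad a_0=-\frac{\operatorname{Im}\big(\sum_{i}\alpha_iz_i\big)}{\operatorname{Im}\tau},$$ and let $T$ be the function $$T(u)=\exp(2i\pi a_0u)\prod_{i=1}^n\theta(u-z_i,\tau)^{\alpha_i},$$ whose determinations on an open set $U\subset\mathbb C$ are obtained by choosing holomorphic determinations on $U$ of the logarithms of the functions $u\mapsto\theta(u-z_i,\tau)$. Then $T$ is a multivalued holomorphic function on $E_\tau\setminus\{[z_1],\dots,[z_n]\}$ with multiplicative unitary monodromy: it has a determination near every $u_0\in\mathbb C$ with $[u_0]\notin\{[z_1],\dots,[z_n]\}$, and if $U\subset\mathbb C$ is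 open and connected, $\lambda\in\mathbb Z\oplus\mathbb Z\tau$, and $T_1$, $T_2$ are determinations of $T$ on $U$ and $U+\lambda$, then $T_2(u+\lambda)=\chi\,T_1(u)$ on $U$ for a constant $\chi$ with $|\chi|=1$. Hence $m=|T(u)\,du|^2$ is a well-defined metric on $E_\tau\setminus\{[z_1],\dots,[z_n]\}$. It is a flat metric in the conformal class of $E_\tau$ with a conical singularity of type $|u^{\alpha_i}du|^2$ at $[z_i]$ for $i=1,\dots,n$, that is, for each $i$ there is a local holomorphic coordinate $w$ of $E_\tau$ centred at $[z_i]$ with $m=|w^{\alpha_i}dw|^2$ near $[z_i]$ (outside that point). Moreover it is the unique such metric up to normalization: the flat metrics on $E_\tau$ in its conformal class with conical singularities of type $|u^{\alpha_i}du|^2$ at $[z_i]$ for $i=1,\dots,n$ are exactly the metrics $c\,m$ with $c>0$ constant. -/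

import Mathlib

open scoped ContDiff

noncomputable section

namespace FlatTorus

/-- The lattice `ℤ ⊕ ℤ τ` in `ℂ`. -/
def lattice (τ : UpperHalfPlane) : AddSubgroup ℂ :=
  AddSubgroup.closure {1, (τ : ℂ)}

/-- The elliptic curve `E_τ = ℂ / (ℤ ⊕ ℤ τ)`. -/
abbrev Curve (τ : UpperHalfPlane) : Type :=
  ℂ ⧸ lattice τ

/-- The class `[u] ∈ E_τ` of `u ∈ ℂ`. -/
def proj (τ : UpperHalfPlane) (u : ℂ) : Curve τ :=
  QuotientAddGroup.mk u

/-- Jacobi's theta function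
`θ(u, τ) = -i ∑_{n ∈ ℤ} (-1)^n exp(iπ (n + 1/2)² τ + 2iπ (n + 1/2) u)`. -/
def theta (u : ℂ) (τ : UpperHalfPlane) : ℂ :=
  -Complex.I * ∑' n : ℤ, (-1 : ℂ) ^ n *
    Complex.exp (Complex.I * Real.pi * ((n : ℂ) + 1 / 2) ^ 2 * (τ : ℂ)
      + 2 * Complex.I * Real.pi * ((n : ℂ) + 1 / 2) * u)

/-- The real number `a₀ = - Im(∑ αᵢ zᵢ) / Im τ`. -/
def a0 (τ : UpperHalfPlane) {n : ℕ} (α : Fin n → ℝ) (z : Fin n → ℂ) : ℝ :=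
  -(∑ i, (α i : ℂ) * z i).im / (τ : ℂ).im

/-- `T` is, on the set `U ⊆ ℂ`, a determination of the multivalued function
`exp(2iπ a₀ u) ∏ θ(u - zᵢ, τ)^{αᵢ}`: the powers are
`θ(u - zᵢ, τ)^{αᵢ} = exp(αᵢ ℓᵢ(u))`, where `ℓᵢ` is a holomorphic determination on `U` of the
logarithm of `u ↦ θ(u - zᵢ, τ)`. -/
def IsDetermination (τ : UpperHalfPlane) {n : ℕ} (α : Fin n → ℝ) (z : Fin n → ℂ)
    (U : Set ℂ) (T : ℂ → ℂ) : Prop :=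
  ∃ ℓ : Fin n → ℂ → ℂ,
    (∀ i, DifferentiableOn ℂ (ℓ i) U) ∧
    (∀ i, ∀ u ∈ U, Complex.exp (ℓ i u) = theta (u - z i) τ) ∧
    ∀ u ∈ U, T u = Complex.exp (2 * Complex.I * Real.pi * (a0 τ α z : ℂ) * u) *
      ∏ i, Complex.exp ((α i : ℂ) * ℓ i u)

/-- A field of real bilinear forms on the tangent planes of `E_τ`. Each tangent plane of `E_τ` is
identified with `ℂ` by the differential of the covering `ℂ → E_τ` (this does not depend on the lift
since the deck transformations are translations). -/
abbrev BilinField (τ : UpperHalfPlane) : Type :=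
  Curve τ → ℂ →L[ℝ] ℂ →L[ℝ] ℝ

/-- `g` is a flat metric on `E_τ`, in the conformal class of `E_τ`, with a conical singularity of
type `|w^{αᵢ} dw|²` at the point `pᵢ` for every `i`. It is a Riemannian metric on the complement of
the `pᵢ`; its values at the `pᵢ` are irrelevant. -/
structure IsFlatConicalMetric (τ : UpperHalfPlane) {n : ℕ} (α : Fin n → ℝ)
    (p : Fin n → Curve τ) (g : BilinField τ) : Prop where
  symm : ∀ q, q ∉ Set.range p → ∀ v w : ℂ, g q v w = g q w v
  pos : ∀ q, q ∉ Set.range p → ∀ v : ℂ, v ≠ 0 → 0 < g q v v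
  smooth : ContDiffOn ℝ ∞ (fun u : ℂ => g (proj τ u)) {u | proj τ u ∉ Set.range p}
  /-- compatibility with the complex structure: rotation by a right angle is an isometry -/
  conformal : ∀ q, q ∉ Set.range p → ∀ v w : ℂ,
    g q (Complex.I * v) (Complex.I * w) = g q v w
  /-- flatness: off the `pᵢ`, the metric is locally the pull-back of the Euclidean metric of the
  plane by a smooth map (which is a local diffeomorphism, as `g` is nondegenerate) -/
  flat : ∀ u₀ : ℂ, proj τ u₀ ∉ Set.range p →
    ∃ (U : Set ℂ) (φ : ℂ → ℂ), IsOpen U ∧ u₀ ∈ U ∧ ContDiffOn ℝ ∞ φ U ∧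
      ∀ u ∈ U, ∀ v w : ℂ, g (proj τ u) v w = inner ℝ (fderiv ℝ φ u v) (fderiv ℝ φ u w)
  /-- conical singularities: there is a holomorphic coordinate `w` centred at `pᵢ` in which the
  metric is `|w^{αᵢ} dw|²` -/
  cone : ∀ i, ∀ u₀ : ℂ, proj τ u₀ = p i →
    ∃ (U : Set ℂ) (w : ℂ → ℂ), IsOpen U ∧ u₀ ∈ U ∧
      DifferentiableOn ℂ w U ∧ Set.InjOn w U ∧ w u₀ = 0 ∧
      ∀ u ∈ U, u ≠ u₀ → ∀ v v' : ℂ,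
        g (proj τ u) v v' = (‖w u‖ ^ α i) ^ 2 * inner ℝ (deriv w u * v) (deriv w u * v')

end FlatTorus

end

noncomputable section

namespace FlatTorus

open Complex Filter Topology Set

variable {τ : UpperHalfPlane}

/-! ### The lattice -/

/-! Everything is read off the modulus `density` of `T`, which is single-valued. Under `u ↦ u + 1`
it does not change; under `u ↦ u + τ` the theta factors contribute an exponential whose
`u`-dependent part is killed by `∑ αᵢ = 0`, and `a0` is chosen to cancel the rest
(`density_add_of_mem`). So `|T|` is doubly periodic, and the ratio of two determinations is
holomorphic of modulus one, hence constant.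

The local shape of `|T|` requires that `θ` vanish exactly on the lattice, with simple zeros.
Jacobi's product has this property visibly and the same quasi-periodicity as `θ`, and `θ` vanishes
on the lattice; the quotient is therefore entire and doubly periodic, so constant. Near a lift `u₀`
of `[zᵢ]` it follows that `|T| = |u - u₀|^αᵢ |K|` with `K` holomorphic and nonvanishing, and
`exists_cone_coordinate` turns this into `|w|^αᵢ |w'|`. Elsewhere a primitive of a determination
develops the metric onto the plane, whence flatness.

For uniqueness, a flat conformal metric has conformal factor `|F|²` locally, with `F` holomorphic
(`exists_analyticAt_conformal_factor`), and at the cones it has the same singular factor as `|T|²`.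
The square root of its ratio to `|T|²` is thus doubly periodic and locally the modulus of a
nonvanishing holomorphic function, so the maximum principle on the compact torus makes it constant.
-/

lemma mem_lattice_iff {u : ℂ} : u ∈ lattice τ ↔ ∃ m n : ℤ, (m : ℂ) + n * (τ : ℂ) = u := by
  simp [lattice, AddSubgroup.mem_closure_pair]

lemma int_add_int_mul_mem_lattice (m n : ℤ) : (m : ℂ) + n * (τ : ℂ) ∈ lattice τ :=
  mem_lattice_iff.2 ⟨m, n, rfl⟩

lemma proj_eq_proj_iff {u v : ℂ} : proj τ u = proj τ v ↔ u - v ∈ lattice τ := by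
  rw [proj, proj, QuotientAddGroup.eq, ← neg_mem_iff]
  congr! 1
  ring

lemma proj_add_of_mem {u l : ℂ} (hl : l ∈ lattice τ) : proj τ (u + l) = proj τ u := by
  rw [proj_eq_proj_iff]; simpa using hl

lemma proj_surjective (q : Curve τ) : ∃ u, proj τ u = q := QuotientAddGroup.mk_surjective q

/-- A compact set meeting every coset of the lattice. -/
lemma exists_isCompact_fundamental (τ : UpperHalfPlane) :
    ∃ K : Set ℂ, IsCompact K ∧ ∀ u : ℂ, ∃ l ∈ lattice τ, ∃ v ∈ K, u = v + l := by
  refine ⟨(fun p : ℝ × ℝ => (p.1 : ℂ) + p.2 * (τ : ℂ)) '' (Icc 0 1 ×ˢ Icc 0 1),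
    (isCompact_Icc.prod isCompact_Icc).image (by fun_prop), fun u => ?_⟩
  set t : ℝ := u.im / (τ : ℂ).im with ht
  set s : ℝ := u.re - t * (τ : ℂ).re with hs
  refine ⟨_, int_add_int_mul_mem_lattice ⌊s⌋ ⌊t⌋, _,
    ⟨(Int.fract s, Int.fract t), ⟨⟨Int.fract_nonneg _, (Int.fract_lt_one _).le⟩,
      ⟨Int.fract_nonneg _, (Int.fract_lt_one _).le⟩⟩, rfl⟩, ?_⟩
  have h1 : ((Int.fract s : ℝ) : ℂ) + ⌊s⌋ = s := by exact_mod_cast Int.fract_add_floor s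
  have h2 : ((Int.fract t : ℝ) : ℂ) + ⌊t⌋ = t := by exact_mod_cast Int.fract_add_floor t
  have h3 : u = s + t * (τ : ℂ) := by
    apply Complex.ext
    · simp [hs]
    · simp [ht, τ.im_pos.ne']
  simp only
  rw [h3, ← h1, ← h2]
  ring

/-! ### Theta-like quasi-periodicity -/

/-- The quasi-periodicity of the theta function. -/
structure IsThetaLike (τ : UpperHalfPlane) (F : ℂ → ℂ) : Prop where
  add_one : ∀ u, F (u + 1) = -F u
  add_tau : ∀ u, F (u + τ) = -cexp (-Real.pi * I * (τ + 2 * u)) * F u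

/-- The factor of automorphy is the same for all theta-like functions. -/
lemma exists_automorphy_factor {l : ℂ} (hl : l ∈ lattice τ) :
    ∃ e : ℂ → ℂ, Differentiable ℂ e ∧ (∀ u, e u ≠ 0) ∧
      ∀ F, IsThetaLike τ F → ∀ u, F (u + l) = e u * F u := by
  induction hl using AddSubgroup.closure_induction with
  | mem x hx =>
    rcases hx with rfl | rfl
    · exact ⟨fun _ => -1, by fun_prop, by simp, fun F hF u => by simp [hF.add_one]⟩
    · exact ⟨fun u => -cexp (-Real.pi * I * (τ + 2 * u)), by fun_prop, by simp,
        fun F hF u => hF.add_tau u⟩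
  | zero => exact ⟨fun _ => 1, by fun_prop, by simp, by simp⟩
  | add x y _ _ hx hy =>
    obtain ⟨e, he, he0, h⟩ := hx
    obtain ⟨e', he', he0', h'⟩ := hy
    refine ⟨fun u => e' (u + x) * e u, by fun_prop, fun u => mul_ne_zero (he0' _) (he0 _),
      fun F hF u => ?_⟩
    rw [← add_assoc, h' F hF, h F hF, mul_assoc]
  | neg x _ hx =>
    obtain ⟨e, he, he0, h⟩ := hx
    refine ⟨fun u => (e (u + -x))⁻¹,
      fun u => ((show Differentiable ℂ fun u => e (u + -x) by fun_prop) u).fun_inv (he0 _),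
      fun u => inv_ne_zero (he0 _), fun F hF u => ?_⟩
    have := h F hF (u + -x)
    rw [neg_add_cancel_right] at this
    rw [this, inv_mul_cancel_left₀ (he0 _)]

lemma IsThetaLike.eq_zero_iff_of_mem {F : ℂ → ℂ} (hF : IsThetaLike τ F) {l : ℂ}
    (hl : l ∈ lattice τ) (u : ℂ) : F (u + l) = 0 ↔ F u = 0 := by
  obtain ⟨e, -, he0, h⟩ := exists_automorphy_factor hl
  simp [h F hF, he0]

/-- Differentiate `F (u + l) = e u * F u` at `0`: the term containing `e'` drops out because `F 0 =
0`. -/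
lemma IsThetaLike.deriv_ne_zero_of_mem {F : ℂ → ℂ} (hF : IsThetaLike τ F)
    (hd : Differentiable ℂ F) (h0 : F 0 = 0) (h0' : deriv F 0 ≠ 0) {l : ℂ}
    (hl : l ∈ lattice τ) : deriv F l ≠ 0 := by
  obtain ⟨e, he, he0, h⟩ := exists_automorphy_factor hl
  have h1 : deriv (fun u => F (u + l)) 0 = deriv F l := by
    rw [deriv_comp_add_const, zero_add]
  have h2 : deriv (fun u => e u * F u) 0 = e 0 * deriv F 0 := by
    rw [deriv_fun_mul (he 0) (hd 0), h0]; simp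
  rw [← h1, funext (h F hF), h2]
  exact mul_ne_zero (he0 0) h0'

/-! ### The theta function -/

/-- Expand `(n + 1/2)²`; the sign `(-1)^n = exp(iπn)` and the cross term `iπnτ` are absorbed into a
translation by the half period `(τ + 1)/2`. -/
lemma theta_eq_jacobiTheta₂ (u : ℂ) : theta u τ =
    -I * (cexp (Real.pi * I * (τ / 4 + u)) * jacobiTheta₂ (u + (τ + 1) / 2) τ) := by
  rw [theta, jacobiTheta₂]
  congr 1
  rw [← tsum_mul_left]
  refine tsum_congr fun n => ?_
  have h : ((-1 : ℂ)) ^ n = cexp (n * (Real.pi * I)) := by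
    rw [exp_int_mul, exp_pi_mul_I]
  rw [h, jacobiTheta₂_term, ← Complex.exp_add, ← Complex.exp_add]
  congr 1
  ring

lemma differentiable_theta : Differentiable ℂ fun u => theta u τ := by
  simp_rw [theta_eq_jacobiTheta₂]
  have h : Differentiable ℂ fun u => jacobiTheta₂ u (τ : ℂ) := fun u =>
    differentiableAt_jacobiTheta₂_fst u τ.im_pos
  have h' : Differentiable ℂ fun u : ℂ => jacobiTheta₂ (u + (τ + 1) / 2) (τ : ℂ) :=
    h.comp (differentiable_id.add_const _)
  fun_prop

lemma isThetaLike_theta : IsThetaLike τ fun u => theta u τ where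
  add_one u := by
    simp only [theta_eq_jacobiTheta₂]
    rw [add_right_comm, jacobiTheta₂_add_left,
      show (Real.pi * I * (τ / 4 + (u + 1)) : ℂ) = Real.pi * I * (τ / 4 + u) + Real.pi * I by ring,
      Complex.exp_add, exp_pi_mul_I]
    ring
  add_tau u := by
    simp only [theta_eq_jacobiTheta₂]
    rw [add_right_comm, jacobiTheta₂_add_left']
    have h : cexp (Real.pi * I * (τ / 4 + (u + τ))) *
        cexp (-Real.pi * I * (τ + 2 * (u + (τ + 1) / 2))) =
        -cexp (-Real.pi * I * (τ + 2 * u)) * cexp (Real.pi * I * (τ / 4 + u)) := by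
      rw [← Complex.exp_add, neg_mul (cexp _), ← Complex.exp_add, ← neg_one_mul (cexp _),
        ← exp_neg_pi_mul_I, ← Complex.exp_add]
      congr 1
      ring
    linear_combination (-I * jacobiTheta₂ (u + (τ + 1) / 2) τ) * h

/-- The half period `(τ + 1)/2` is congruent to its opposite modulo the lattice, and evenness with
quasi-periodicity gives the multiplier `-1` there. -/
lemma theta_zero : theta 0 τ = 0 := by
  have h : jacobiTheta₂ ((τ + 1) / 2) (τ : ℂ) = -jacobiTheta₂ ((τ + 1) / 2) (τ : ℂ) := by
    calc jacobiTheta₂ ((τ + 1) / 2) (τ : ℂ)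
        = jacobiTheta₂ (-((τ + 1) / 2) + 1 + τ) (τ : ℂ) := by congr 1; ring
      _ = _ := by
        rw [jacobiTheta₂_add_left', jacobiTheta₂_add_left, jacobiTheta₂_neg_left,
          show (-Real.pi * I * (τ + 2 * (-((τ + 1) / 2) + 1)) : ℂ) = -(Real.pi * I) by ring,
          Complex.exp_neg, exp_pi_mul_I]
        ring
  rw [theta_eq_jacobiTheta₂, zero_add, self_eq_neg.1 h]
  simp

/-- The zeroth Fourier coefficient of the theta series is `1`. -/
lemma integral_jacobiTheta₂ (τ : UpperHalfPlane) :
    ∫ x in (0 : ℝ)..1, jacobiTheta₂ x (τ : ℂ) = 1 := by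
  have hterm : ∀ n : ℤ, ∀ x : ℝ, jacobiTheta₂_term n x τ =
      cexp (Real.pi * I * n ^ 2 * τ) * cexp ((2 * Real.pi * I * n) * x) := fun n x => by
    rw [jacobiTheta₂_term, ← Complex.exp_add, add_comm]
  have hint : ∀ n : ℤ, ∫ x in (0 : ℝ)..1, jacobiTheta₂_term n x (τ : ℂ) =
      if n = 0 then 1 else 0 := fun n => by
    simp_rw [hterm]
    rw [intervalIntegral.integral_const_mul]
    split_ifs with h
    · simp [h]
    · rw [integral_exp_mul_complex (by simp [h, Real.pi_ne_zero])]
      have : cexp (2 * Real.pi * I * n) = 1 := by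
        rw [mul_comm]; exact exp_int_mul_two_pi_mul_I n
      simp [this]
  have hs := intervalIntegral.hasSum_intervalIntegral_of_summable_norm (a := 0) (b := 1)
    (ι := ℤ) (E := ℂ)
    (f := fun n => ⟨fun x : ℝ => jacobiTheta₂_term n x (τ : ℂ), by
      unfold jacobiTheta₂_term; fun_prop⟩) ?_
  · simp only [ContinuousMap.coe_mk, hint] at hs
    exact hs.unique (hasSum_ite_eq (0 : ℤ) (1 : ℂ))
  -- For real `x` the norm of each term is independent of `x`, so summability at `0` is a uniform
  -- majorant.
  · have h0 := (summable_jacobiTheta₂_term_iff 0 (τ : ℂ)).2 τ.im_pos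
    refine Summable.of_nonneg_of_le (fun _ => norm_nonneg _) (fun n => ?_) h0.norm
    rw [ContinuousMap.norm_le _ (norm_nonneg _)]
    intro x
    simp [norm_jacobiTheta₂_term]

lemma exists_theta_ne_zero (τ : UpperHalfPlane) : ∃ u, theta u τ ≠ 0 := by
  by_contra! h
  have h1 : ∀ x : ℂ, jacobiTheta₂ x (τ : ℂ) = 0 := fun x => by
    have := h (x - (τ + 1) / 2)
    rw [theta_eq_jacobiTheta₂] at this
    simpa using this
  simpa [h1] using integral_jacobiTheta₂ τ

/-! ### The product side -/

/-- The `q`-Pochhammer symbol `∏_{n ≥ 0} (1 - qⁿ y)`. -/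
def qPochhammer (q y : ℂ) : ℂ := ∏' n : ℕ, (1 + -(q ^ n * y))

lemma summable_norm_pow_mul {q : ℂ} (hq : ‖q‖ < 1) (y : ℂ) :
    Summable fun n : ℕ => ‖-(q ^ n * y)‖ := by
  simpa using (summable_geometric_of_lt_one (norm_nonneg q) hq).mul_right ‖y‖

lemma differentiable_qPochhammer {q : ℂ} (hq : ‖q‖ < 1) : Differentiable ℂ (qPochhammer q) := by
  have h : HasProdLocallyUniformlyOn (fun (n : ℕ) (y : ℂ) => 1 + -(q ^ n * y))
      (fun y => ∏' n : ℕ, (1 + -(q ^ n * y))) univ := by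
    apply hasProdLocallyUniformlyOn_of_forall_compact isOpen_univ
    intro K _ hK
    obtain ⟨C, hC⟩ := hK.isBounded.exists_norm_le
    refine ((summable_geometric_of_lt_one (norm_nonneg q) hq).mul_right C).hasProdUniformlyOn_nat_one_add
      hK (.of_forall fun n y hy => ?_) (fun _ => by fun_prop)
    rw [norm_neg, norm_mul, norm_pow]
    exact mul_le_mul_of_nonneg_left (hC y hy) (by positivity)
  rw [← differentiableOn_univ]
  exact h.differentiableOn (.of_forall fun _ => by
    simpa [Finset.prod_fn] using
      DifferentiableOn.finsetProd (fun _ _ => by fun_prop)) isOpen_univ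

/-- Split off the factor `n = 0`. This is the source of both the quasi-periodicity of `thetaProd`
and its simple zero at the origin. -/
lemma qPochhammer_eq {q : ℂ} (hq : ‖q‖ < 1) (y : ℂ) :
    qPochhammer q y = (1 - y) * qPochhammer q (q * y) := by
  have h := (multipliable_one_add_of_summable (summable_norm_pow_mul hq (q * y)))
  have h' : (fun n : ℕ => 1 + -(q ^ (n + 1) * y)) = fun n => 1 + -(q ^ n * (q * y)) := by
    ext n; ring
  rw [qPochhammer, tprod_eq_zero_mul' (by rw [h']; exact h), h', qPochhammer]
  simp [sub_eq_add_neg]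

lemma exists_of_qPochhammer_eq_zero {q : ℂ} (hq : ‖q‖ < 1) {y : ℂ} (h : qPochhammer q y = 0) :
    ∃ n : ℕ, q ^ n * y = 1 := by
  by_contra! h'
  refine tprod_one_add_ne_zero_of_summable (f := fun n : ℕ => -(q ^ n * y)) (fun n hn => h' n ?_)
    (summable_norm_pow_mul hq y) h
  linear_combination -hn

/-- The nome `exp(2iπτ)`. -/
def nome (τ : UpperHalfPlane) : ℂ := cexp (2 * Real.pi * I * τ)

lemma norm_nome_lt_one (τ : UpperHalfPlane) : ‖nome τ‖ < 1 := by
  rw [nome, Complex.norm_exp, Real.exp_lt_one_iff]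
  have := mul_pos Real.two_pi_pos τ.im_pos
  simpa using this

lemma qPochhammer_nome_ne_zero (τ : UpperHalfPlane) : qPochhammer (nome τ) (nome τ) ≠ 0 := by
  intro h
  obtain ⟨n, hn⟩ := exists_of_qPochhammer_eq_zero (norm_nome_lt_one τ) h
  rw [← pow_succ] at hn
  have h1 := congrArg norm hn
  rw [norm_pow, norm_one] at h1
  exact (pow_lt_one₀ (norm_nonneg _) (norm_nome_lt_one τ) n.succ_ne_zero).ne h1

/-- The product in Jacobi's triple product formula for `θ`. -/
def thetaProd (τ : UpperHalfPlane) (u : ℂ) : ℂ :=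
  cexp (-Real.pi * I * u) * (qPochhammer (nome τ) (cexp (2 * Real.pi * I * u)) *
    qPochhammer (nome τ) (nome τ * cexp (-(2 * Real.pi * I * u))))

lemma differentiable_thetaProd (τ : UpperHalfPlane) : Differentiable ℂ (thetaProd τ) := by
  have h := differentiable_qPochhammer (norm_nome_lt_one τ)
  unfold thetaProd
  fun_prop

/-- Adding `τ` to `u` multiplies `y = exp(2iπu)` by the nome: one symbol loses the factor `1 - y`,
the other gains `1 - y⁻¹`, and the ratio is `-y⁻¹`. -/
lemma isThetaLike_thetaProd (τ : UpperHalfPlane) : IsThetaLike τ (thetaProd τ) where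
  add_one u := by
    have h1 : cexp (-Real.pi * I * (u + 1)) = -cexp (-Real.pi * I * u) := by
      rw [mul_add, mul_one, Complex.exp_add, neg_mul, exp_neg_pi_mul_I]; ring
    have h2 : cexp (2 * Real.pi * I * (u + 1)) = cexp (2 * Real.pi * I * u) := by
      rw [mul_add, mul_one, Complex.exp_add, exp_two_pi_mul_I, mul_one]
    rw [thetaProd, thetaProd, h1, Complex.exp_neg, Complex.exp_neg, h2]
    ring
  add_tau u := by
    have hq := norm_nome_lt_one τ
    have h0 := Complex.exp_ne_zero (2 * Real.pi * I * u)
    have hq0 : nome τ ≠ 0 := Complex.exp_ne_zero _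
    have h2 : cexp (2 * Real.pi * I * (u + τ)) = nome τ * cexp (2 * Real.pi * I * u) := by
      rw [mul_add, Complex.exp_add, nome]; ring
    have h3 : cexp (-Real.pi * I * (τ + 2 * u)) * cexp (-Real.pi * I * u) *
        cexp (2 * Real.pi * I * u) = cexp (-Real.pi * I * (u + τ)) := by
      rw [← Complex.exp_add, ← Complex.exp_add]; congr 1; ring
    have h4 := qPochhammer_eq hq (cexp (2 * Real.pi * I * u))
    have h5 := qPochhammer_eq hq (cexp (-(2 * Real.pi * I * u)))
    rw [thetaProd, thetaProd, ← h3, Complex.exp_neg (2 * Real.pi * I * (u + τ)), h2, mul_inv,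
      mul_inv_cancel_left₀ hq0, ← Complex.exp_neg, h5, h4, Complex.exp_neg]
    field_simp
    ring

lemma mem_lattice_of_exp_eq_one {u : ℂ} (m : ℤ)
    (h : cexp (2 * Real.pi * I * (u + m * (τ : ℂ))) = 1) : u ∈ lattice τ := by
  obtain ⟨k, hk⟩ := Complex.exp_eq_one_iff.1 h
  refine mem_lattice_iff.2 ⟨k, -m, ?_⟩
  have : (2 * Real.pi * I : ℂ) ≠ 0 := two_pi_I_ne_zero
  have h1 := mul_left_cancel₀ this (hk.trans (mul_comm _ _))
  push_cast
  linear_combination -h1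

lemma nome_pow (n : ℕ) : nome τ ^ n = cexp (2 * Real.pi * I * (n * τ)) := by
  rw [nome, ← Complex.exp_nat_mul]; congr 1; ring

lemma mem_lattice_of_thetaProd_eq_zero {u : ℂ} (h : thetaProd τ u = 0) : u ∈ lattice τ := by
  have hq := norm_nome_lt_one τ
  rcases mul_eq_zero.1 ((mul_eq_zero.1 h).resolve_left (Complex.exp_ne_zero _)) with h | h
  · obtain ⟨n, hn⟩ := exists_of_qPochhammer_eq_zero hq h
    refine mem_lattice_of_exp_eq_one (n : ℤ) ?_
    rw [nome_pow, ← Complex.exp_add] at hn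
    rw [← hn]; congr 1; push_cast; ring
  · obtain ⟨n, hn⟩ := exists_of_qPochhammer_eq_zero hq h
    rw [← neg_mem_iff]
    refine mem_lattice_of_exp_eq_one ((n + 1 : ℕ) : ℤ) ?_
    rw [← mul_assoc, ← pow_succ, nome_pow, ← Complex.exp_add] at hn
    rw [← hn]; congr 1; push_cast; ring

lemma thetaProd_zero : thetaProd τ 0 = 0 := by
  have := qPochhammer_eq (norm_nome_lt_one τ) 1
  simp [thetaProd, this]

lemma deriv_thetaProd_zero_ne_zero : deriv (thetaProd τ) 0 ≠ 0 := by
  -- `E` is the product with the factor `1 - exp(2iπu)` removed, and `E 0` is the square of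
  -- `qPochhammer (nome τ) (nome τ)`, which is nonzero.
  have hq := norm_nome_lt_one τ
  set E : ℂ → ℂ := fun u => cexp (-Real.pi * I * u) *
    (qPochhammer (nome τ) (nome τ * cexp (2 * Real.pi * I * u)) *
      qPochhammer (nome τ) (nome τ * cexp (-(2 * Real.pi * I * u)))) with hE
  have hEd : Differentiable ℂ E := by
    have h := differentiable_qPochhammer hq
    fun_prop
  have h1 : thetaProd τ = fun u => (1 - cexp (2 * Real.pi * I * u)) * E u := by
    ext u
    rw [thetaProd, qPochhammer_eq hq (cexp (2 * Real.pi * I * u)), hE]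
    ring
  have h2 : HasDerivAt (fun u => 1 - cexp (2 * Real.pi * I * u)) (-(2 * Real.pi * I)) 0 := by
    have : HasDerivAt (fun u : ℂ => 2 * Real.pi * I * u) (2 * Real.pi * I) 0 := by
      simpa using (hasDerivAt_id (0 : ℂ)).const_mul (2 * Real.pi * I : ℂ)
    simpa using this.cexp.const_sub 1
  have h3 := (h2.mul (hEd 0).hasDerivAt).deriv
  have h4 : ((fun u => 1 - cexp (2 * Real.pi * I * u)) * E) = thetaProd τ := by rw [h1]; rfl
  rw [h4] at h3
  rw [h3]
  simp [hE, qPochhammer_nome_ne_zero, Real.pi_ne_zero]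

/-! ### Comparison of theta-like functions -/

/-- An entire function is divisible by an entire function with simple zeros if it vanishes at
those. -/
lemma exists_eq_mul_of_simple_zeros {f g : ℂ → ℂ} (hf : Differentiable ℂ f)
    (hg : Differentiable ℂ g) (h : ∀ u, g u = 0 → f u = 0 ∧ deriv g u ≠ 0) :
    ∃ k : ℂ → ℂ, Differentiable ℂ k ∧ ∀ u, f u = k u * g u := by
  classical
  -- The values at the zeros are those of l'Hôpital's rule: near a zero `u` the quotient is `dslope
  -- f u / dslope g u`, whose denominator does not vanish at `u`.
  refine ⟨fun u => if g u = 0 then deriv f u / deriv g u else f u / g u, fun u => ?_, fun u => ?_⟩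
  · by_cases hu : g u = 0
    · obtain ⟨hfu, hgu⟩ := h u hu
      have hdf : Differentiable ℂ (dslope f u) := by
        rw [← differentiableOn_univ, Complex.differentiableOn_dslope univ_mem]
        exact hf.differentiableOn
      have hdg : Differentiable ℂ (dslope g u) := by
        rw [← differentiableOn_univ, Complex.differentiableOn_dslope univ_mem]
        exact hg.differentiableOn
      have hne : dslope g u u ≠ 0 := by rwa [dslope_same]
      refine ((hdf u).fun_div (hdg u) hne).congr_of_eventuallyEq ?_
      filter_upwards [hdg.continuous.continuousAt.eventually_ne hne] with v hv
      rcases eq_or_ne v u with rfl | hvu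
      · simp [hu]
      · have h1 : (v - u) * dslope f u v = f v := by simpa [hfu] using sub_smul_dslope f u v
        have h2 : (v - u) * dslope g u v = g v := by simpa [hu] using sub_smul_dslope g u v
        have h3 : g v ≠ 0 := by rw [← h2]; exact mul_ne_zero (sub_ne_zero.2 hvu) hv
        rw [if_neg h3, ← h1, ← h2, mul_div_mul_left _ _ (sub_ne_zero.2 hvu)]
    · refine ((hf u).fun_div (hg u) hu).congr_of_eventuallyEq ?_
      filter_upwards [hg.continuous.continuousAt.eventually_ne hu] with v hv
      rw [if_neg hv]
  · by_cases hu : g u = 0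
    · simp [hu, (h u hu).1]
    · simp [hu]

/-- A doubly periodic entire function is constant. -/
lemma eq_const_of_periodic {k : ℂ → ℂ} (hk : Differentiable ℂ k)
    (hper : ∀ l ∈ lattice τ, ∀ u, k (u + l) = k u) (u v : ℂ) : k u = k v := by
  obtain ⟨K, hK, h⟩ := exists_isCompact_fundamental τ
  refine hk.apply_eq_apply_of_bounded ((hK.image hk.continuous).isBounded.subset ?_) u v
  rintro _ ⟨w, rfl⟩
  obtain ⟨l, hl, v, hv, rfl⟩ := h w
  exact ⟨v, hv, (hper l hl v).symm⟩

/-- Two theta-like functions, one with simple zeros at which the other vanishes, are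
proportional. -/
lemma IsThetaLike.exists_eq_const_mul {f g : ℂ → ℂ} (hf : IsThetaLike τ f) (hg : IsThetaLike τ g)
    (hfd : Differentiable ℂ f) (hgd : Differentiable ℂ g)
    (h : ∀ u, g u = 0 → f u = 0 ∧ deriv g u ≠ 0) : ∃ c : ℂ, ∀ u, f u = c * g u := by
  obtain ⟨k, hk, hfk⟩ := exists_eq_mul_of_simple_zeros hfd hgd h
  refine ⟨k 0, fun u => ?_⟩
  rw [hfk u, eq_const_of_periodic hk (τ := τ) (fun l hl => ?_) u 0]
  obtain ⟨e, he, he0, hF⟩ := exists_automorphy_factor hl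
  -- The common automorphy factor cancels wherever `g` is nonzero; the identity theorem then gives
  -- periodicity everywhere.
  have hzero : ∀ v, g v ≠ 0 → k (v + l) = k v := fun v hv => by
    have h1 := hfk (v + l)
    rw [hF f hf, hF g hg, hfk v] at h1
    have h2 : (e v * g v) * (k (v + l) - k v) = 0 := by linear_combination -h1
    rcases mul_eq_zero.1 h2 with h2 | h2
    · exact absurd h2 (mul_ne_zero (he0 v) hv)
    · exact sub_eq_zero.1 h2
  have hex : ∃ v, g v ≠ 0 := by
    by_contra! hg0
    refine (h 0 (hg0 0)).2 ?_
    rw [show g = fun _ => 0 from funext hg0]; simp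
  obtain ⟨v, hv⟩ := hex
  have hk' : Differentiable ℂ fun u => k (u + l) := by fun_prop
  have := (hk'.differentiableOn (s := univ)).analyticOnNhd isOpen_univ |>.eq_of_eventuallyEq
    ((hk.differentiableOn (s := univ)).analyticOnNhd isOpen_univ) (z₀ := v)
    (by filter_upwards [hgd.continuous.continuousAt.eventually_ne hv] with w hw using hzero w hw)
  exact congrFun this

/-- **Jacobi's product formula**, up to a constant. -/
lemma exists_theta_eq_const_mul (τ : UpperHalfPlane) :
    ∃ c : ℂ, c ≠ 0 ∧ ∀ u, theta u τ = c * thetaProd τ u := by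
  obtain ⟨c, hc⟩ := IsThetaLike.exists_eq_const_mul (isThetaLike_theta (τ := τ))
    (isThetaLike_thetaProd τ) differentiable_theta (differentiable_thetaProd τ) fun u hu => by
      have hl := mem_lattice_of_thetaProd_eq_zero hu
      refine ⟨?_, (isThetaLike_thetaProd τ).deriv_ne_zero_of_mem (differentiable_thetaProd τ)
        thetaProd_zero deriv_thetaProd_zero_ne_zero hl⟩
      have := (isThetaLike_theta (τ := τ)).eq_zero_iff_of_mem hl 0
      rw [zero_add] at this
      exact this.2 theta_zero
  refine ⟨c, ?_, hc⟩
  rintro rfl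
  obtain ⟨u, hu⟩ := exists_theta_ne_zero τ
  exact hu (by simp [hc])

lemma theta_eq_zero_iff {u : ℂ} : theta u τ = 0 ↔ u ∈ lattice τ := by
  refine ⟨fun h => ?_, fun h => ?_⟩
  · obtain ⟨c, hc, h'⟩ := exists_theta_eq_const_mul τ
    exact mem_lattice_of_thetaProd_eq_zero ((mul_eq_zero.1 ((h' u).symm.trans h)).resolve_left hc)
  · have := (isThetaLike_theta (τ := τ)).eq_zero_iff_of_mem h 0
    rw [zero_add] at this
    exact this.2 theta_zero

lemma deriv_theta_ne_zero {u : ℂ} (hu : u ∈ lattice τ) : deriv (fun u => theta u τ) u ≠ 0 := by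
  obtain ⟨c, hc, h'⟩ := exists_theta_eq_const_mul τ
  rw [funext h', deriv_const_mul _ (differentiable_thetaProd τ u)]
  exact mul_ne_zero hc ((isThetaLike_thetaProd τ).deriv_ne_zero_of_mem (differentiable_thetaProd τ)
    thetaProd_zero deriv_thetaProd_zero_ne_zero hu)

/-! ### Local complex analysis -/

/-- Dividing by `K u₀` brings the values near `1`, away from the branch cut. -/
lemma exists_analyticAt_log {K : ℂ → ℂ} {u₀ : ℂ} (hK : AnalyticAt ℂ K u₀) (h0 : K u₀ ≠ 0) :
    ∃ L : ℂ → ℂ, AnalyticAt ℂ L u₀ ∧ ∀ᶠ u in 𝓝 u₀, cexp (L u) = K u := by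
  refine ⟨fun u => log (K u / K u₀) + log (K u₀), ?_, ?_⟩
  · refine AnalyticAt.add (AnalyticAt.clog (hK.div analyticAt_const h0) ?_) analyticAt_const
    simp [h0]
  · filter_upwards [hK.continuousAt.eventually_ne h0] with u hu
    rw [Complex.exp_add, exp_log (div_ne_zero hu h0), exp_log h0, div_mul_cancel₀ _ h0]

lemma norm_exp_ofReal_mul (a : ℝ) (l : ℂ) : ‖cexp (a * l)‖ = ‖cexp l‖ ^ a := by
  rw [Complex.norm_exp, Complex.norm_exp, ← Real.exp_mul, re_ofReal_mul, mul_comm]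

lemma exists_analyticAt_norm_eq_rpow {K : ℂ → ℂ} {u₀ : ℂ} (hK : AnalyticAt ℂ K u₀)
    (h0 : K u₀ ≠ 0) (a : ℝ) :
    ∃ P : ℂ → ℂ, AnalyticAt ℂ P u₀ ∧ P u₀ ≠ 0 ∧ ∀ᶠ u in 𝓝 u₀, ‖P u‖ = ‖K u‖ ^ a := by
  obtain ⟨L, hL, h⟩ := exists_analyticAt_log hK h0
  refine ⟨fun u => cexp (a * L u), (analyticAt_const.mul hL).cexp, Complex.exp_ne_zero _, ?_⟩
  filter_upwards [h] with u hu
  rw [norm_exp_ofReal_mul, hu]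

/-! ### Normal form of a cone metric -/

/-- The solution of `P + b s P' = K` which is holomorphic at the origin. -/
lemma exists_analyticAt_add_mul_deriv_eq {K : ℂ → ℂ} (hK : AnalyticAt ℂ K 0) {b : ℝ}
    (hb : 0 < b) : ∃ P : ℂ → ℂ, AnalyticAt ℂ P 0 ∧ P 0 = K 0 ∧
      ∀ᶠ s in 𝓝 (0 : ℂ), P s + b * s * deriv P s = K s := by
  obtain ⟨R, hR, hKR⟩ := Metric.eventually_nhds_iff_ball.1 hK.eventually_analyticAt
  have hKd : ∀ s ∈ Metric.ball (0 : ℂ) R, DifferentiableAt ℂ K s :=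
    fun s hs => (hKR s hs).differentiableAt
  -- The solution is `P(s) = ∫₀¹ K(r^b s) dr`, which sends `s^k` to `s^k / (1 + b k)`. The equation
  -- is the fundamental theorem of calculus for `r ↦ r K(r^b s)`.
  set γ : ℝ → ℂ := fun r => ((r ^ b : ℝ) : ℂ) with hγ
  have hγc : Continuous γ := by
    have := Real.continuous_rpow_const hb.le
    fun_prop
  have hγ1 : ∀ r ∈ Icc (0 : ℝ) 1, ‖γ r‖ ≤ 1 := fun r hr => by
    rw [hγ, norm_real, Real.norm_of_nonneg (Real.rpow_nonneg hr.1 _)]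
    exact Real.rpow_le_one hr.1 hr.2 hb.le
  have hmem : ∀ ρ : ℝ, ∀ r ∈ Icc (0 : ℝ) 1, ∀ s ∈ Metric.ball (0 : ℂ) ρ,
      γ r * s ∈ Metric.ball (0 : ℂ) ρ := fun ρ r hr s hs => by
    rw [mem_ball_zero_iff] at hs ⊢
    rw [norm_mul]
    exact (mul_le_of_le_one_left (norm_nonneg _) (hγ1 r hr)).trans_lt hs
  have huIcc : uIcc (0 : ℝ) 1 = Icc 0 1 := uIcc_of_le zero_le_one
  have huIoc : uIoc (0 : ℝ) 1 ⊆ Icc 0 1 := by rw [uIoc_of_le zero_le_one]; exact Ioc_subset_Icc_self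
  have hc : ∀ s ∈ Metric.ball (0 : ℂ) R, ContinuousOn (fun r => K (γ r * s)) (Icc 0 1) :=
    fun s hs r hr => by
      have h1 := (hKd _ (hmem R r hr s hs)).continuousAt
      exact (h1.comp (f := fun r => γ r * s) (by fun_prop)).continuousWithinAt
  have hc' : ∀ s ∈ Metric.ball (0 : ℂ) R,
      ContinuousOn (fun r => γ r * deriv K (γ r * s)) (Icc 0 1) :=
    fun s hs r hr => by
      have h1 := (hKR _ (hmem R r hr s hs)).deriv.continuousAt
      exact (hγc.continuousAt.mul
        (h1.comp (f := fun r => γ r * s) (by fun_prop))).continuousWithinAt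
  set P : ℂ → ℂ := fun s => ∫ r in (0 : ℝ)..1, K (γ r * s) with hP
  have hder : ∀ s ∈ Metric.ball (0 : ℂ) R,
      HasDerivAt P (∫ r in (0 : ℝ)..1, γ r * deriv K (γ r * s)) s := fun s hs => by
    obtain ⟨ρ, hsρ, hρR⟩ := exists_between (mem_ball_zero_iff.1 hs)
    have hsub : Metric.closedBall (0 : ℂ) ρ ⊆ Metric.ball 0 R := Metric.closedBall_subset_ball hρR
    obtain ⟨C, hC⟩ := (isCompact_closedBall (0 : ℂ) ρ).exists_bound_of_continuousOn
      (f := deriv K) fun x hx => (hKR x (hsub hx)).deriv.continuousAt.continuousWithinAt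
    refine (intervalIntegral.hasDerivAt_integral_of_dominated_loc_of_deriv_le
      (s := Metric.ball 0 ρ) (bound := fun _ => C)
      (F := fun x r => K (γ r * x)) (F' := fun x r => γ r * deriv K (γ r * x))
      (Metric.isOpen_ball.mem_nhds (mem_ball_zero_iff.2 hsρ)) ?_ ?_ ?_ ?_ ?_ ?_).2
    · filter_upwards [Metric.isOpen_ball.mem_nhds hs] with x hx
      exact ((hc x hx).mono huIoc).aestronglyMeasurable measurableSet_uIoc
    · exact ContinuousOn.intervalIntegrable (by rw [huIcc]; exact hc s hs)
    · exact ((hc' s hs).mono huIoc).aestronglyMeasurable measurableSet_uIoc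
    · refine .of_forall fun r hr x hx => ?_
      have h1 := hC _ (Metric.ball_subset_closedBall (hmem ρ r (huIoc hr) x hx))
      rw [norm_mul]
      exact (mul_le_of_le_one_left (norm_nonneg _) (hγ1 r (huIoc hr))).trans h1
    · exact intervalIntegrable_const
    · refine .of_forall fun r hr x hx => ?_
      have h1 := (hKd _ (hsub (Metric.ball_subset_closedBall
        (hmem ρ r (huIoc hr) x hx)))).hasDerivAt
      have h2 : HasDerivAt (fun x => γ r * x) (γ r) x := by
        simpa using (hasDerivAt_id x).const_mul (γ r)
      rw [mul_comm]
      exact h1.comp x h2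
  refine ⟨P, ?_, by simp [hP], ?_⟩
  · refine DifferentiableOn.analyticAt (s := Metric.ball 0 R)
      (fun s hs => (hder s hs).differentiableAt.differentiableWithinAt)
      (Metric.ball_mem_nhds _ hR)
  · filter_upwards [Metric.ball_mem_nhds (0 : ℂ) hR] with s hs
    rw [(hder s hs).deriv, hP, ← intervalIntegral.integral_const_mul,
      ← intervalIntegral.integral_add (ContinuousOn.intervalIntegrable (by rw [huIcc]; exact hc s hs))
        (ContinuousOn.intervalIntegrable (by
          rw [huIcc]; exact continuousOn_const.mul (hc' s hs)))]
    have hftc := intervalIntegral.integral_eq_sub_of_hasDerivAt_of_le zero_le_one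
      (f := fun r : ℝ => (r : ℂ) * K (γ r * s))
      (f' := fun r => K (γ r * s) + b * s * (γ r * deriv K (γ r * s)))
      (continuous_ofReal.continuousOn.mul (hc s hs)) ?_ ?_
    · rw [hftc]
      simp [hγ]
    · intro r hr
      have h1 := (hKd _ (hmem R r (Ioo_subset_Icc_self hr) s hs)).hasDerivAt
      have h2 : HasDerivAt γ ((b * r ^ (b - 1) : ℝ) : ℂ) r :=
        (Real.hasDerivAt_rpow_const (Or.inl hr.1.ne')).ofReal_comp
      have h3 := h1.scomp r (h2.mul_const s)
      have h4 := (hasDerivAt_id r).ofReal_comp.mul h3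
      refine h4.congr_deriv ?_
      have h5 : ((r ^ b : ℝ) : ℂ) = r * ((r ^ (b - 1) : ℝ) : ℂ) := by
        rw [← ofReal_mul, ← Real.rpow_one_add' hr.1.le (by simpa using hb.ne')]
        congr 2; ring
      simp only [hγ, h5, smul_eq_mul, Function.comp, id]
      push_cast
      ring
    · refine ContinuousOn.intervalIntegrable ?_
      rw [huIcc]
      exact (hc s hs).add (continuousOn_const.mul (hc' s hs))

/-- A primitive of `s^a K` is `s^(a+1) P / (a+1)` when `P + b s P' = K` with `b = 1/(a+1)`. The
coordinate `w = s W` should satisfy `w^(a+1) = s^(a+1) P`, so `W = P^b`; only moduli matter, so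
branches play no role. -/
lemma exists_analyticAt_norm_rpow_mul_norm_eq {K : ℂ → ℂ} (hK : AnalyticAt ℂ K 0) (h0 : K 0 ≠ 0)
    {a : ℝ} (ha : -1 < a) : ∃ W : ℂ → ℂ, AnalyticAt ℂ W 0 ∧ W 0 ≠ 0 ∧
      ∀ᶠ s in 𝓝 (0 : ℂ), ‖W s‖ ^ a * ‖W s + s * deriv W s‖ = ‖K s‖ := by
  have ha' : 0 < a + 1 := by linarith
  obtain ⟨P, hP, hP0, hPK⟩ := exists_analyticAt_add_mul_deriv_eq hK (inv_pos.2 ha')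
  obtain ⟨L, hL, hLP⟩ := exists_analyticAt_log hP (hP0 ▸ h0)
  set b : ℝ := (a + 1)⁻¹ with hb
  refine ⟨fun s => cexp (b * L s), (analyticAt_const.mul hL).cexp, Complex.exp_ne_zero _, ?_⟩
  filter_upwards [hPK, hLP.eventually_nhds, hL.eventually_analyticAt] with s hs hLs hLa
  have hd := hLa.differentiableAt.hasDerivAt
  have h1 : deriv (fun s => cexp (b * L s)) s = cexp (b * L s) * (b * deriv L s) :=
    (hd.const_mul (b : ℂ)).cexp.deriv
  have h2 : deriv P s = P s * deriv L s := by
    rw [← Filter.EventuallyEq.deriv_eq hLs, hd.cexp.deriv, hLs.self_of_nhds]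
  have h3 : cexp (b * L s) + s * deriv (fun s => cexp (b * L s)) s =
      cexp (b * L s) * (1 + b * s * deriv L s) := by rw [h1]; ring
  have h4 : ‖cexp (b * L s)‖ ^ a * ‖cexp (b * L s)‖ = ‖P s‖ := by
    have hpos : 0 < ‖cexp (b * L s)‖ := norm_pos_iff.2 (Complex.exp_ne_zero _)
    rw [← Real.rpow_add_one hpos.ne', norm_exp_ofReal_mul, ← Real.rpow_mul (norm_nonneg _), hb,
      inv_mul_cancel₀ ha'.ne', Real.rpow_one, hLs.self_of_nhds]
  rw [h3, norm_mul, ← mul_assoc, h4, ← norm_mul, ← hs, h2]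
  congr 1
  ring

/-- A holomorphic coordinate in which a conformal cone metric takes its normal form. -/
lemma exists_cone_coordinate {K : ℂ → ℂ} {u₀ : ℂ} (hK : AnalyticAt ℂ K u₀) (h0 : K u₀ ≠ 0)
    {a : ℝ} (ha : -1 < a) : ∃ w : ℂ → ℂ, AnalyticAt ℂ w u₀ ∧ w u₀ = 0 ∧ deriv w u₀ ≠ 0 ∧
      ∀ᶠ u in 𝓝 u₀, ‖w u‖ ^ a * ‖deriv w u‖ = ‖u - u₀‖ ^ a * ‖K u‖ := by
  have hK' : AnalyticAt ℂ (fun s => K (s + u₀)) 0 := by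
    refine AnalyticAt.fun_comp (g := K) (f := fun s => s + u₀) (by simpa using hK) (by fun_prop)
  obtain ⟨W, hW, hW0, h⟩ := exists_analyticAt_norm_rpow_mul_norm_eq hK' (by simpa using h0) ha
  have hlim : Tendsto (fun u => u - u₀) (𝓝 u₀) (𝓝 0) := by
    have : ContinuousAt (fun u => u - u₀) u₀ := by fun_prop
    simpa [ContinuousAt] using this
  have hWa : AnalyticAt ℂ (fun u => W (u - u₀)) u₀ :=
    AnalyticAt.fun_comp (g := W) (f := fun s => s - u₀) (by simpa using hW) (by fun_prop)
  have hder : ∀ᶠ u in 𝓝 u₀, deriv (fun u => (u - u₀) * W (u - u₀)) u =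
      W (u - u₀) + (u - u₀) * deriv W (u - u₀) := by
    filter_upwards [hlim.eventually hW.eventually_analyticAt] with u hu
    have h1 : HasDerivAt (fun u => u - u₀) 1 u := (hasDerivAt_id u).sub_const u₀
    have h2 := h1.mul (hu.differentiableAt.hasDerivAt.comp u h1)
    have h3 := h2.deriv
    simp only [one_mul, mul_one, Function.comp_def] at h3
    exact h3
  refine ⟨fun u => (u - u₀) * W (u - u₀),
    (analyticAt_id.sub analyticAt_const).mul hWa, by simp, ?_, ?_⟩
  · rw [hder.self_of_nhds]; simpa using hW0
  · filter_upwards [hder, hlim.eventually h] with u hu hu'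
    rw [hu, norm_mul, Real.mul_rpow (norm_nonneg _) (norm_nonneg _), mul_assoc, hu']
    simp

lemma exists_injOn_of_deriv_ne_zero {w : ℂ → ℂ} {u₀ : ℂ} (hw : AnalyticAt ℂ w u₀)
    (h : deriv w u₀ ≠ 0) : ∃ V ∈ 𝓝 u₀, InjOn w V := by
  have hs := hw.hasStrictDerivAt.hasStrictFDerivAt_equiv h
  exact ⟨_, (hs.toOpenPartialHomeomorph w).open_source.mem_nhds
    hs.mem_toOpenPartialHomeomorph_source, (hs.toOpenPartialHomeomorph w).injOn⟩

/-- Otherwise `w - w u₀ = v^n` for a local coordinate `v` and some `n ≥ 2`, and two points whose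
`v`-values differ by a primitive `n`-th root of unity have the same image. -/
lemma deriv_ne_zero_of_injOn {w : ℂ → ℂ} {u₀ : ℂ} (hw : AnalyticAt ℂ w u₀) {U : Set ℂ}
    (hU : U ∈ 𝓝 u₀) (hinj : InjOn w U) : deriv w u₀ ≠ 0 := by
  intro hd
  have hf : AnalyticAt ℂ (fun u => w u - w u₀) u₀ := hw.sub analyticAt_const
  have hnc : ¬ ∀ᶠ u in 𝓝 u₀, w u - w u₀ = 0 := fun hc => by
    have h1 : ∀ᶠ u in 𝓝[≠] u₀, False := by
      filter_upwards [hc.filter_mono nhdsWithin_le_nhds, mem_nhdsWithin_of_mem_nhds hU,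
        self_mem_nhdsWithin] with u hu huU hne
      exact hne (hinj huU (mem_of_mem_nhds hU) (sub_eq_zero.1 hu))
    simpa using h1.exists
  obtain ⟨n, g, hg, hg0, hfg⟩ := hf.exists_eventuallyEq_pow_smul_nonzero_iff.2 hnc
  obtain ⟨L, hL, hLg⟩ := exists_analyticAt_log hg hg0
  have hn0 : n ≠ 0 := by
    rintro rfl
    have := hfg.self_of_nhds
    simp at this
    exact hg0 this.symm
  have hnC : (n : ℂ) ≠ 0 := Nat.cast_ne_zero.2 hn0
  have hn1 : n ≠ 1 := by
    rintro rfl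
    have h1 : deriv (fun u => w u - w u₀) u₀ = deriv (fun u => (u - u₀) * g u) u₀ := by
      apply Filter.EventuallyEq.deriv_eq
      filter_upwards [hfg] with u hu
      simpa using hu
    have h2 : HasDerivAt (fun u => u - u₀) 1 u₀ := (hasDerivAt_id u₀).sub_const u₀
    have h3 := (h2.mul hg.differentiableAt.hasDerivAt).deriv
    rw [deriv_sub_const, hd] at h1
    simp only [sub_self, zero_mul, one_mul, add_zero] at h3
    exact hg0 (h3.symm.trans h1.symm)
  set v : ℂ → ℂ := fun u => (u - u₀) * cexp (L u / n) with hv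
  have hva : AnalyticAt ℂ v u₀ := by
    have : AnalyticAt ℂ (fun u => L u / n) u₀ := hL.div analyticAt_const hnC
    exact (analyticAt_id.sub analyticAt_const).mul this.cexp
  have hv0 : v u₀ = 0 := by simp [hv]
  have hvd : deriv v u₀ ≠ 0 := by
    have h2 : HasDerivAt (fun u => u - u₀) 1 u₀ := (hasDerivAt_id u₀).sub_const u₀
    have h3 := (h2.mul (hL.differentiableAt.hasDerivAt.div_const (n : ℂ)).cexp).deriv
    simp only [sub_self, zero_mul, one_mul, add_zero] at h3
    have h4 : deriv v u₀ = cexp (L u₀ / n) := h3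
    rw [h4]; exact Complex.exp_ne_zero _
  have hvn : ∀ᶠ u in 𝓝 u₀, v u ^ n = w u - w u₀ := by
    filter_upwards [hfg, hLg] with u hu hu'
    rw [hu, hv, mul_pow, ← Complex.exp_nat_mul, mul_div_cancel₀ _ hnC, hu', smul_eq_mul]
  have himg : v '' (U ∩ {u | v u ^ n = w u - w u₀}) ∈ 𝓝 (0 : ℂ) := by
    have := hva.hasStrictDerivAt.map_nhds_eq hvd
    rw [hv0] at this
    rw [← this]
    exact image_mem_map (inter_mem hU hvn)
  obtain ⟨ε, hε, hball⟩ := Metric.mem_nhds_iff.1 himg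
  set ζ : ℂ := cexp (2 * Real.pi * I / n) with hζ
  have hprim : IsPrimitiveRoot ζ n := Complex.isPrimitiveRoot_exp n hn0
  have hy : ((ε / 2 : ℝ) : ℂ) ∈ Metric.ball (0 : ℂ) ε := by
    rw [mem_ball_zero_iff, norm_real, Real.norm_of_nonneg (by positivity)]; linarith
  have hy' : ζ * ((ε / 2 : ℝ) : ℂ) ∈ Metric.ball (0 : ℂ) ε := by
    rw [mem_ball_zero_iff, norm_mul, hprim.norm'_eq_one hn0, one_mul]
    exact mem_ball_zero_iff.1 hy
  obtain ⟨u₁, ⟨hu₁, hu₁'⟩, h₁⟩ := hball hy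
  obtain ⟨u₂, ⟨hu₂, hu₂'⟩, h₂⟩ := hball hy'
  have hw12 : w u₁ = w u₂ := by
    have h3 : v u₁ ^ n = v u₂ ^ n := by rw [h₁, h₂, mul_pow, hprim.pow_eq_one, one_mul]
    rw [hu₁', hu₂'] at h3
    exact sub_left_injective h3
  have h12 := hinj hu₁ hu₂ hw12
  rw [← h12, h₁] at h₂
  have hne : ((ε / 2 : ℝ) : ℂ) ≠ 0 := ofReal_ne_zero.2 (by positivity)
  exact hprim.ne_one (by omega) (mul_right_cancel₀ hne (by rw [one_mul]; exact h₂.symm))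

lemma inner_mul_mul (a v w : ℂ) : inner ℝ (a * v) (a * w) = ‖a‖ ^ 2 * inner ℝ v w := by
  rw [Complex.inner, Complex.inner, ← Complex.normSq_eq_norm_sq, Complex.normSq_apply]
  simp
  ring

/-! ### Conformal local isometries of the plane -/

/-- The hypothesis on `fderiv ℝ φ u I` is the Cauchy–Riemann equation, so `F = φ'` works. -/
lemma exists_analyticAt_of_isometry_of_fderiv_I {B : Set ℂ} {u₀ : ℂ} (hB : B ∈ 𝓝 u₀)
    {φ : ℂ → ℂ} {h : ℂ → ℝ} (hφ : ∀ u ∈ B, DifferentiableAt ℝ φ u)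
    (hI : ∀ u ∈ B, fderiv ℝ φ u I = I * fderiv ℝ φ u 1)
    (hpos : 0 < h u₀) (hh : ∀ u ∈ B, ‖fderiv ℝ φ u 1‖ ^ 2 = h u) :
    ∃ F : ℂ → ℂ, AnalyticAt ℂ F u₀ ∧ F u₀ ≠ 0 ∧ ∀ᶠ u in 𝓝 u₀, h u = ‖F u‖ ^ 2 := by
  have hφ' : ∀ u ∈ B, DifferentiableAt ℂ φ u := fun u hu =>
    differentiableAt_complex_iff_differentiableAt_real.2 ⟨hφ u hu, hI u hu⟩
  have hder : ∀ u ∈ B, deriv φ u = fderiv ℝ φ u 1 := fun u hu => by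
    rw [((hφ' u hu).hasDerivAt.hasFDerivAt.restrictScalars ℝ).fderiv]
    simp
  have hφa : AnalyticAt ℂ φ u₀ :=
    DifferentiableOn.analyticAt (fun u hu => (hφ' u hu).differentiableWithinAt) hB
  refine ⟨deriv φ, hφa.deriv, fun h0 => ?_, ?_⟩
  · have := hh u₀ (mem_of_mem_nhds hB)
    rw [← hder u₀ (mem_of_mem_nhds hB), h0] at this
    simp only [norm_zero, ne_eq, OfNat.ofNat_ne_zero, not_false_eq_true, zero_pow] at this
    exact hpos.ne this
  · filter_upwards [hB] with u hu
    rw [hder u hu, hh u hu]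

/-- A conformal smooth map is locally holomorphic or antiholomorphic, hence its conformal factor is
locally the squared modulus of a holomorphic function. -/
lemma exists_analyticAt_conformal_factor {U : Set ℂ} {u₀ : ℂ} (hU : IsOpen U) (hu₀ : u₀ ∈ U)
    {φ : ℂ → ℂ} (hφ : ContDiffOn ℝ ∞ φ U) {h : ℂ → ℝ} (hpos : ∀ u ∈ U, 0 < h u)
    (hiso : ∀ u ∈ U, ∀ v w : ℂ, inner ℝ (fderiv ℝ φ u v) (fderiv ℝ φ u w) = h u * inner ℝ v w) :
    ∃ F : ℂ → ℂ, AnalyticAt ℂ F u₀ ∧ F u₀ ≠ 0 ∧ ∀ᶠ u in 𝓝 u₀, h u = ‖F u‖ ^ 2 := by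
  obtain ⟨r, hr, hrU⟩ := Metric.isOpen_iff.1 hU u₀ hu₀
  set B := Metric.ball u₀ r with hB
  have hBn : B ∈ 𝓝 u₀ := Metric.ball_mem_nhds _ hr
  have hd : ∀ u ∈ B, DifferentiableAt ℝ φ u := fun u hu =>
    (hφ.contDiffAt (hU.mem_nhds (hrU hu))).differentiableAt (by simp)
  have hnorm : ∀ u ∈ B, ‖fderiv ℝ φ u 1‖ ^ 2 = h u := fun u hu => by
    rw [← real_inner_self_eq_norm_sq, hiso u (hrU hu)]
    simp
  have hne : ∀ u ∈ B, fderiv ℝ φ u 1 ≠ 0 := fun u hu h0 => by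
    have := hnorm u hu
    rw [h0] at this
    simp only [norm_zero, ne_eq, OfNat.ofNat_ne_zero, not_false_eq_true, zero_pow] at this
    exact (hpos u (hrU hu)).ne this
  have hcont : ContinuousOn (fderiv ℝ φ) B :=
    (hφ.continuousOn_fderiv_of_isOpen hU (by simp)).mono hrU
  -- A similarity of the plane sends `I` to `± I` times the image of `1`. Squaring removes the sign,
  -- which connectedness of the ball then makes uniform.
  have hsq : EqOn ((fun u => fderiv ℝ φ u I) ^ 2) ((fun u => I * fderiv ℝ φ u 1) ^ 2) B := by
    intro u hu
    have h1 := hiso u (hrU hu) 1 1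
    have h2 := hiso u (hrU hu) I I
    have h3 := hiso u (hrU hu) 1 I
    simp only [Pi.pow_apply, mul_pow, I_sq]
    generalize fderiv ℝ φ u 1 = a at *
    generalize fderiv ℝ φ u I = b at *
    have ha := hnorm u hu
    simp only [Complex.inner] at h1 h2 h3
    simp at h1 h2 h3
    have hb : 0 < a.re * a.re + a.im * a.im := by rw [h1]; exact hpos u (hrU hu)
    apply Complex.ext
    · simp only [sq, mul_re, neg_mul, one_mul, neg_re]
      refine mul_left_cancel₀ hb.ne' ?_
      linear_combination 2 * (b.re * a.re - b.im * a.im) * h3 +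
        (a.im ^ 2 - a.re ^ 2) * (h2 - h1)
    · simp only [sq, mul_im, neg_mul, one_mul, neg_im]
      refine mul_left_cancel₀ hb.ne' ?_
      linear_combination 2 * (a.im * b.re + a.re * b.im) * h3 -
        2 * a.re * a.im * (h2 - h1)
  rcases (convex_ball u₀ r).isPreconnected.eq_or_eq_neg_of_sq_eq
    (hcont.clm_apply continuousOn_const)
    (continuousOn_const.mul (hcont.clm_apply continuousOn_const)) hsq
    (fun {u} hu => mul_ne_zero I_ne_zero (hne u hu)) with hI | hI
  · exact exists_analyticAt_of_isometry_of_fderiv_I hBn hd hI (hpos u₀ hu₀) hnorm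
  -- In the antiholomorphic case, the conjugate of `φ` is holomorphic with the same conformal
  -- factor.
  · have hfd : ∀ u ∈ B, fderiv ℝ (fun u => conjCLE (φ u)) u =
        (conjCLE : ℂ →L[ℝ] ℂ).comp (fderiv ℝ φ u) := fun u hu =>
      ((conjCLE : ℂ →L[ℝ] ℂ).hasFDerivAt.comp u (hd u hu).hasFDerivAt).fderiv
    refine exists_analyticAt_of_isometry_of_fderiv_I (φ := fun u => conjCLE (φ u)) hBn
      (fun u hu => ((conjCLE : ℂ →L[ℝ] ℂ).hasFDerivAt.comp u (hd u hu).hasFDerivAt).differentiableAt)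
      (fun u hu => ?_) (hpos u₀ hu₀) fun u hu => ?_
    · have := hI hu
      simp only [Pi.neg_apply] at this
      rw [hfd u hu]
      simp [this]
    · rw [hfd u hu]
      simp [hnorm u hu]

/-! ### A maximum principle on the torus -/

/-- A doubly periodic function which is locally, up to isolated points, the modulus of a
nonvanishing holomorphic function is constant. -/
lemma exists_eq_const_of_periodic_of_locally_norm {G : ℂ → ℝ}
    (hper : ∀ l ∈ lattice τ, ∀ u, G (u + l) = G u)
    (hloc : ∀ u₀, ∃ F : ℂ → ℂ, AnalyticAt ℂ F u₀ ∧ F u₀ ≠ 0 ∧ ∀ᶠ u in 𝓝[≠] u₀, G u = ‖F u‖) :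
    ∃ c : ℝ, 0 < c ∧ ∀ u, ContinuousAt G u → G u = c := by
  choose F hFa hF0 hF using hloc
  -- `H` takes at each point the limit of `G` there, which corrects arbitrary values of `G` at
  -- isolated points.
  set H : ℂ → ℝ := fun u => ‖F u u‖ with hH
  have htend : ∀ u, Tendsto G (𝓝[≠] u) (𝓝 (H u)) := fun u =>
    (((hFa u).continuousAt.norm).tendsto.mono_left nhdsWithin_le_nhds).congr'
      ((hF u).mono fun _ h => h.symm)
  have hHloc : ∀ u₀, ∀ᶠ u in 𝓝 u₀, H u = ‖F u₀ u‖ := fun u₀ => by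
    have h1 : ∀ᶠ u in 𝓝 u₀, u ≠ u₀ → G u = ‖F u₀ u‖ := by
      simpa [eventually_nhdsWithin_iff] using hF u₀
    filter_upwards [h1.eventually_nhds, (hFa u₀).eventually_analyticAt] with u hu hua
    rcases eq_or_ne u u₀ with rfl | hne
    · rfl
    · refine tendsto_nhds_unique (htend u)
        ((hua.continuousAt.norm.tendsto.mono_left nhdsWithin_le_nhds).congr' ?_)
      filter_upwards [hu.filter_mono nhdsWithin_le_nhds,
        (eventually_ne_nhds hne).filter_mono nhdsWithin_le_nhds] with v hv hvne
      exact (hv hvne).symm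
  have hHc : Continuous H := continuous_iff_continuousAt.2 fun u =>
    ((hFa u).continuousAt.norm).congr ((hHloc u).mono fun _ h => h.symm)
  have hHper : ∀ l ∈ lattice τ, ∀ u, H (u + l) = H u := fun l hl u => by
    refine tendsto_nhds_unique ?_ (htend u)
    have h1 : Tendsto (fun v => v + l) (𝓝[≠] u) (𝓝[≠] (u + l)) := by
      refine tendsto_nhdsWithin_iff.2 ⟨?_, ?_⟩
      · have : ContinuousAt (fun v => v + l) u := by fun_prop
        exact this.tendsto.mono_left nhdsWithin_le_nhds
      · filter_upwards [self_mem_nhdsWithin] with v hv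
        simpa using hv
    exact ((htend (u + l)).comp h1).congr fun v => hper l hl v
  obtain ⟨K, hK, hKf⟩ := exists_isCompact_fundamental τ
  have hKne : K.Nonempty := by
    obtain ⟨_, _, v, hv, _⟩ := hKf 0
    exact ⟨v, hv⟩
  obtain ⟨p, hpK, hp⟩ := hK.exists_isMaxOn hKne hHc.continuousOn
  have hmax : ∀ u, H u ≤ H p := fun u => by
    obtain ⟨l, hl, v, hv, rfl⟩ := hKf u
    rw [hHper l hl]
    exact hp hv
  -- The local maximum principle for `F u` shows that the maximum of `H` is attained on an open set,
  -- which is also closed.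
  have hopen : IsOpen {u | H u = H p} := isOpen_iff_mem_nhds.2 fun u hu => by
    have hu' : H u = H p := hu
    have h1 := Complex.norm_eventually_eq_of_isLocalMax
      (f := F u) ((hFa u).eventually_analyticAt.mono fun _ h => h.differentiableAt) (c := u) (by
        filter_upwards [hHloc u] with v hv
        have := hmax v
        rw [hv, ← hu'] at this
        exact this)
    filter_upwards [h1, hHloc u] with v hv hv'
    show H v = H p
    rw [hv', hv, ← hu']
  have huniv : {u | H u = H p} = univ :=
    IsClopen.eq_univ ⟨isClosed_eq hHc continuous_const, hopen⟩ ⟨p, rfl⟩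
  refine ⟨H p, norm_pos_iff.2 (hF0 p), fun u hu => ?_⟩
  rw [← show H u = H p from huniv.ge (mem_univ u)]
  exact tendsto_nhds_unique (hu.tendsto.mono_left nhdsWithin_le_nhds) (htend u)

variable {n : ℕ} {α : Fin n → ℝ} {z : Fin n → ℂ}

/-! ### The punctured plane -/

/-- The complement in `ℂ` of the lifts of the points `[zᵢ]`. -/
def puncturedPlane (τ : UpperHalfPlane) (z : Fin n → ℂ) : Set ℂ :=
  {u | proj τ u ∉ range fun i => proj τ (z i)}

lemma mem_puncturedPlane_iff {u : ℂ} :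
    u ∈ puncturedPlane τ z ↔ ∀ i, theta (u - z i) τ ≠ 0 := by
  simp only [puncturedPlane, mem_ofPred_eq, mem_range, not_exists, ne_eq, theta_eq_zero_iff,
    ← proj_eq_proj_iff, eq_comm]

lemma differentiable_theta_sub (a : ℂ) : Differentiable ℂ fun u => theta (u - a) τ :=
  (differentiable_theta (τ := τ)).comp (differentiable_id.sub_const a)

lemma deriv_theta_sub_ne_zero {u a : ℂ} (h : theta (u - a) τ = 0) :
    deriv (fun u => theta (u - a) τ) u ≠ 0 := by
  rw [deriv_comp_sub_const (f := fun u => theta u τ)]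
  exact deriv_theta_ne_zero (theta_eq_zero_iff.1 h)

lemma isOpen_puncturedPlane : IsOpen (puncturedPlane τ z) := by
  have : puncturedPlane τ z = ⋂ i, {u | theta (u - z i) τ ≠ 0} := by
    ext u; simp [mem_puncturedPlane_iff]
  rw [this]
  exact isOpen_iInter_of_finite fun i =>
    isOpen_ne_fun (differentiable_theta_sub (z i)).continuous continuous_const

lemma eventually_mem_puncturedPlane (u₀ : ℂ) : ∀ᶠ u in 𝓝[≠] u₀, u ∈ puncturedPlane τ z := by
  simp only [mem_puncturedPlane_iff, eventually_all]
  intro i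
  have hd := differentiable_theta_sub (τ := τ) (z i)
  by_cases h : theta (u₀ - z i) τ = 0
  · exact (hd u₀).hasDerivAt.eventually_ne (deriv_theta_sub_ne_zero h)
  · exact (hd.continuous.continuousAt.eventually_ne h).filter_mono nhdsWithin_le_nhds

lemma analyticAt_dslope {f : ℂ → ℂ} {u₀ : ℂ} (hf : AnalyticAt ℂ f u₀) :
    AnalyticAt ℂ (dslope f u₀) u₀ := by
  obtain ⟨s, hs, hfs⟩ := hf.exists_mem_nhds_analyticOnNhd
  exact ((Complex.differentiableOn_dslope hs).2 hfs.differentiableOn).analyticAt hs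

/-! ### The modulus of `T` -/

/-- The modulus of the multivalued function `T`. -/
def density (τ : UpperHalfPlane) (α : Fin n → ℝ) (z : Fin n → ℂ) (u : ℂ) : ℝ :=
  ‖cexp (2 * I * Real.pi * (a0 τ α z : ℂ) * u)‖ * ∏ i, ‖theta (u - z i) τ‖ ^ α i

lemma IsDetermination.norm_eq {U : Set ℂ} {T : ℂ → ℂ} (hT : IsDetermination τ α z U T) {u : ℂ}
    (hu : u ∈ U) : ‖T u‖ = density τ α z u := by
  obtain ⟨ℓ, -, hexp, h⟩ := hT
  rw [h u hu, norm_mul, norm_prod, density]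
  congr 1
  exact Finset.prod_congr rfl fun i _ => by rw [norm_exp_ofReal_mul, hexp i u hu]

lemma IsDetermination.ne_zero {U : Set ℂ} {T : ℂ → ℂ} (hT : IsDetermination τ α z U T) {u : ℂ}
    (hu : u ∈ U) : T u ≠ 0 := by
  obtain ⟨ℓ, -, -, h⟩ := hT
  rw [h u hu]
  exact mul_ne_zero (Complex.exp_ne_zero _)
    (Finset.prod_ne_zero_iff.2 fun i _ => Complex.exp_ne_zero _)

lemma IsDetermination.differentiableOn {U : Set ℂ} {T : ℂ → ℂ}
    (hT : IsDetermination τ α z U T) : DifferentiableOn ℂ T U := by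
  obtain ⟨ℓ, hℓ, -, h⟩ := hT
  refine DifferentiableOn.congr ?_ h
  have h1 : ∀ i, DifferentiableOn ℂ (fun u => cexp ((α i : ℂ) * ℓ i u)) U := fun i =>
    ((hℓ i).const_mul (α i : ℂ)).cexp
  have h2 : DifferentiableOn ℂ (fun u => ∏ i, cexp ((α i : ℂ) * ℓ i u)) U :=
    DifferentiableOn.fun_finsetProd fun i _ => h1 i
  have h3 : DifferentiableOn ℂ (fun u => cexp (2 * I * Real.pi * (a0 τ α z : ℂ) * u)) U := by
    fun_prop
  exact h3.mul h2

lemma exists_isDetermination (α : Fin n → ℝ) {u₀ : ℂ} (h : u₀ ∈ puncturedPlane τ z) :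
    ∃ (U : Set ℂ) (T : ℂ → ℂ), IsOpen U ∧ u₀ ∈ U ∧ IsDetermination τ α z U T := by
  rw [mem_puncturedPlane_iff] at h
  choose L hL hexp using fun i => exists_analyticAt_log
    ((differentiable_theta_sub (τ := τ) (z i)).analyticAt u₀) (h i)
  have hev : ∀ᶠ u in 𝓝 u₀, ∀ i, cexp (L i u) = theta (u - z i) τ ∧ AnalyticAt ℂ (L i) u :=
    eventually_all.2 fun i => (hexp i).and (hL i).eventually_analyticAt
  obtain ⟨U, hU, hUo, hu₀⟩ := eventually_nhds_iff.1 hev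
  exact ⟨U, _, hUo, hu₀, L,
    fun i u hu => (hU u hu i).2.differentiableAt.differentiableWithinAt,
    fun i u hu => (hU u hu i).1, fun u _ => rfl⟩

lemma density_pos {u : ℂ} (hu : u ∈ puncturedPlane τ z) : 0 < density τ α z u := by
  rw [mem_puncturedPlane_iff] at hu
  exact mul_pos (norm_pos_iff.2 (Complex.exp_ne_zero _))
    (Finset.prod_pos fun i _ => Real.rpow_pos_of_pos (norm_pos_iff.2 (hu i)) _)

lemma a0_mul_im (τ : UpperHalfPlane) (α : Fin n → ℝ) (z : Fin n → ℂ) :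
    a0 τ α z * (τ : ℂ).im = -∑ i, α i * (z i).im := by
  have : (τ : ℂ).im ≠ 0 := τ.im_pos.ne'
  rw [a0, div_mul_cancel₀ _ this, Complex.im_sum]
  simp

lemma norm_exp_mul_a0 (a : ℝ) (u : ℂ) :
    ‖cexp (2 * I * Real.pi * (a : ℂ) * u)‖ = Real.exp (-(2 * Real.pi * (a * u.im))) := by
  rw [Complex.norm_exp]
  congr 1
  simp
  ring

/-- Under translation by `τ`, the `i`-th theta factor is multiplied by `exp(αᵢ π (Im τ + 2 Im u) -
2π αᵢ Im zᵢ)`. The first part cancels in the product since `∑ αᵢ = 0`, the second against the factor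
from `a0`. -/
lemma density_add_of_mem (hsum : ∑ i, α i = 0) {l : ℂ} (hl : l ∈ lattice τ) :
    ∀ u, density τ α z (u + l) = density τ α z u := by
  induction hl using AddSubgroup.closure_induction with
  | mem x hx =>
    intro u
    rcases hx with rfl | rfl
    · rw [density, density, norm_exp_mul_a0, norm_exp_mul_a0]
      congr 1
      · simp
      · refine Finset.prod_congr rfl fun i _ => ?_
        rw [add_sub_right_comm, (isThetaLike_theta (τ := τ)).add_one, norm_neg]
    · have h1 : ∀ i, ‖theta (u + τ - z i) τ‖ ^ α i =
          Real.exp (α i * (Real.pi * ((τ : ℂ).im + 2 * u.im)) - 2 * Real.pi * (α i * (z i).im)) *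
            ‖theta (u - z i) τ‖ ^ α i := fun i => by
        rw [add_sub_right_comm, (isThetaLike_theta (τ := τ)).add_tau, norm_mul, norm_neg,
          Real.mul_rpow (norm_nonneg _) (norm_nonneg _), Complex.norm_exp, ← Real.exp_mul]
        congr 2
        simp
        ring
      rw [density, density, norm_exp_mul_a0, norm_exp_mul_a0]
      simp only [h1]
      rw [Finset.prod_mul_distrib, ← Real.exp_sum, Finset.sum_sub_distrib, ← Finset.sum_mul, hsum,
        ← Finset.mul_sum, ← mul_assoc, ← Real.exp_add]
      congr 2
      rw [add_im, mul_add, a0_mul_im]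
      ring
  | zero => simp
  | add x y _ _ hx hy => intro u; rw [← add_assoc, hy, hx]
  | neg x _ hx => intro u; rw [← hx (u + -x), neg_add_cancel_right]

lemma exists_analyticAt_norm_eq_prod (u₀ : ℂ) (s : Finset (Fin n))
    (h : ∀ i ∈ s, theta (u₀ - z i) τ ≠ 0) :
    ∃ F : ℂ → ℂ, AnalyticAt ℂ F u₀ ∧ F u₀ ≠ 0 ∧
      ∀ᶠ u in 𝓝 u₀, ∏ i ∈ s, ‖theta (u - z i) τ‖ ^ α i = ‖F u‖ := by
  induction s using Finset.cons_induction with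
  | empty => exact ⟨fun _ => 1, analyticAt_const, one_ne_zero, by simp⟩
  | cons i s hi ih =>
    obtain ⟨F, hF, hF0, hF'⟩ := ih fun j hj => h j (Finset.mem_cons_of_mem hj)
    obtain ⟨P, hP, hP0, hP'⟩ := exists_analyticAt_norm_eq_rpow
      ((differentiable_theta_sub (τ := τ) (z i)).analyticAt u₀)
      (h i (Finset.mem_cons_self i s)) (α i)
    refine ⟨fun u => P u * F u, hP.mul hF, mul_ne_zero hP0 hF0, ?_⟩
    filter_upwards [hF', hP'] with u h1 h2
    rw [Finset.prod_cons, h1, norm_mul, h2]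

lemma exists_analyticAt_density_eq {u₀ : ℂ} (h : u₀ ∈ puncturedPlane τ z) :
    ∃ F : ℂ → ℂ, AnalyticAt ℂ F u₀ ∧ F u₀ ≠ 0 ∧ ∀ᶠ u in 𝓝 u₀, density τ α z u = ‖F u‖ := by
  obtain ⟨F, hF, hF0, hF'⟩ := exists_analyticAt_norm_eq_prod (α := α) u₀ Finset.univ
    fun i _ => mem_puncturedPlane_iff.1 h i
  refine ⟨fun u => cexp (2 * I * Real.pi * (a0 τ α z : ℂ) * u) * F u, by fun_prop,
    mul_ne_zero (Complex.exp_ne_zero _) hF0, ?_⟩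
  filter_upwards [hF'] with u hu
  rw [density, hu, norm_mul]

/-- As the classes are distinct, only the `i`-th theta factor vanishes at `u₀`, and its zero is
simple: it is `u - u₀` times a nonvanishing `dslope`. -/
lemma exists_analyticAt_density_eq_rpow_mul
    (hz : Function.Injective fun i => proj τ (z i)) {u₀ : ℂ} {i : Fin n}
    (h : proj τ u₀ = proj τ (z i)) :
    ∃ K : ℂ → ℂ, AnalyticAt ℂ K u₀ ∧ K u₀ ≠ 0 ∧
      ∀ᶠ u in 𝓝 u₀, density τ α z u = ‖u - u₀‖ ^ α i * ‖K u‖ := by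
  have hi : theta (u₀ - z i) τ = 0 := theta_eq_zero_iff.2 (proj_eq_proj_iff.1 h)
  obtain ⟨F, hF, hF0, hF'⟩ := exists_analyticAt_norm_eq_prod (α := α) (z := z) (τ := τ) u₀
    (Finset.univ.erase i) fun j hj hj0 => (Finset.mem_erase.1 hj).1 <| hz <|
      (proj_eq_proj_iff.2 (theta_eq_zero_iff.1 hj0)).symm.trans h
  have ha : AnalyticAt ℂ (fun u => theta (u - z i) τ) u₀ :=
    (differentiable_theta_sub (z i)).analyticAt u₀
  obtain ⟨P, hP, hP0, hP'⟩ := exists_analyticAt_norm_eq_rpow (analyticAt_dslope ha)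
    (by rw [dslope_same]; exact deriv_theta_sub_ne_zero hi) (α i)
  refine ⟨fun u => cexp (2 * I * Real.pi * (a0 τ α z : ℂ) * u) * (P u * F u), by fun_prop,
    mul_ne_zero (Complex.exp_ne_zero _) (mul_ne_zero hP0 hF0), ?_⟩
  filter_upwards [hF', hP'] with u h1 h2
  have h3 : theta (u - z i) τ = (u - u₀) * dslope (fun u => theta (u - z i) τ) u₀ u := by
    have := sub_smul_dslope (fun u => theta (u - z i) τ) u₀ u
    rw [hi, sub_zero] at this
    exact this.symm
  rw [density, ← Finset.mul_prod_erase _ _ (Finset.mem_univ i), h1, h3, norm_mul, norm_mul,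
    norm_mul, Real.mul_rpow (norm_nonneg _) (norm_nonneg _), h2]
  ring

/-! ### The metric `|T(u) du|²` -/

/-- The Euclidean inner product of `ℂ` as a continuous bilinear form. -/
def innerForm : ℂ →L[ℝ] ℂ →L[ℝ] ℝ := innerSL ℝ

@[simp] lemma innerForm_apply (v w : ℂ) : innerForm v w = inner ℝ v w := rfl

/-- The metric `|T(u) du|²` on the punctured curve. -/
def metric (τ : UpperHalfPlane) (α : Fin n → ℝ) (z : Fin n → ℂ) : BilinField τ :=
  fun q => density τ α z (Quotient.out q) ^ 2 • innerForm

lemma metric_proj (hsum : ∑ i, α i = 0) (u : ℂ) :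
    metric τ α z (proj τ u) = density τ α z u ^ 2 • innerForm := by
  have h : proj τ (Quotient.out (proj τ u)) = proj τ u := Quotient.out_eq _
  have h' := density_add_of_mem (α := α) (z := z) hsum (proj_eq_proj_iff.1 h) u
  rw [add_sub_cancel] at h'
  rw [metric, h']

/-- The free constant `c` lets the same argument treat `m` and all its positive multiples. -/
lemma isFlatConicalMetric_of_forall_eq (hα : ∀ i, -1 < α i)
    (hz : Function.Injective fun i => proj τ (z i)) {g : BilinField τ} {c : ℝ} (hc : 0 < c)
    (hg : ∀ u ∈ puncturedPlane τ z, g (proj τ u) = (c * density τ α z u) ^ 2 • innerForm) :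
    IsFlatConicalMetric τ α (fun i => proj τ (z i)) g := by
  have happ : ∀ u ∈ puncturedPlane τ z, ∀ v w,
      g (proj τ u) v w = (c * density τ α z u) ^ 2 * inner ℝ v w := fun u hu v w => by
    rw [hg u hu]; rfl
  have hcC : (c : ℂ) ≠ 0 := ofReal_ne_zero.2 hc.ne'
  have hcn : ‖(c : ℂ)‖ = c := by rw [norm_real, Real.norm_of_nonneg hc.le]
  refine ⟨fun q hq v w => ?_, fun q hq v hv => ?_, fun u hu => ?_, fun q hq v w => ?_,
    fun u hu => ?_, fun i u₀ hu₀ => ?_⟩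
  · obtain ⟨u, rfl⟩ := proj_surjective q
    rw [happ u hq, happ u hq, real_inner_comm]
  · obtain ⟨u, rfl⟩ := proj_surjective q
    rw [happ u hq, real_inner_self_eq_norm_sq]
    have := density_pos (α := α) (z := z) hq
    have := norm_pos_iff.2 hv
    positivity
  · obtain ⟨F, hF, hF0, hFd⟩ := exists_analyticAt_density_eq (α := α) hu
    have hF' : ContDiffAt ℝ ∞ F u := (hF.contDiffAt (n := ∞)).restrict_scalars ℝ
    have := @NormedSpace.toIsBoundedSMul ℝ (ℂ →L[ℝ] ℂ →L[ℝ] ℝ) _ _ _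
    have h1 : ContDiffAt ℝ ∞ (fun u => (c ^ 2 * ‖F u‖ ^ 2) • innerForm) u :=
      (contDiffAt_const.mul (hF'.norm_sq ℝ)).smul contDiffAt_const
    refine (h1.congr_of_eventuallyEq ?_).contDiffWithinAt
    filter_upwards [hFd, isOpen_puncturedPlane.mem_nhds hu] with v hv hv'
    rw [hg v hv', hv, mul_pow]
  · obtain ⟨u, rfl⟩ := proj_surjective q
    rw [happ u hq, happ u hq, inner_mul_mul]
    simp
  · obtain ⟨F, hF, hF0, hFd⟩ := exists_analyticAt_density_eq (α := α) hu
    obtain ⟨r, hr, hball⟩ := Metric.eventually_nhds_iff_ball.1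
      (hF.eventually_analyticAt.and (hFd.and (isOpen_puncturedPlane.mem_nhds hu)))
    have hd : DifferentiableOn ℂ (fun u => (c : ℂ) * F u) (Metric.ball u r) := fun v hv =>
      ((hball v hv).1.differentiableAt.const_mul (c : ℂ)).differentiableWithinAt
    -- The developing map is a primitive of `c F`.
    obtain ⟨φ, hφ⟩ := hd.isExactOn_ball
    refine ⟨Metric.ball u r, φ, Metric.isOpen_ball, Metric.mem_ball_self hr, ?_, ?_⟩
    · have h1 : DifferentiableOn ℂ φ (Metric.ball u r) := fun v hv =>
        (hφ v hv).differentiableAt.differentiableWithinAt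
      exact (h1.contDiffOn (n := ∞) Metric.isOpen_ball).restrict_scalars ℝ
    · intro v hv a b
      rw [((hφ v hv).hasFDerivAt.restrictScalars ℝ).fderiv, happ v (hball v hv).2.2,
        (hball v hv).2.1]
      simp only [ContinuousLinearMap.coe_restrictScalars', ContinuousLinearMap.toSpanSingleton_apply,
        smul_eq_mul]
      rw [mul_comm a, mul_comm b, inner_mul_mul, norm_mul, hcn]
  · obtain ⟨K, hK, hK0, hKd⟩ := exists_analyticAt_density_eq_rpow_mul (α := α) hz hu₀
    obtain ⟨w, hw, hw0, hw', hwK⟩ := exists_cone_coordinate (K := fun u => c * K u)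
      (analyticAt_const.mul hK) (mul_ne_zero hcC hK0) (hα i)
    obtain ⟨V, hV, hinj⟩ := exists_injOn_of_deriv_ne_zero hw hw'
    have hreg : ∀ᶠ u in 𝓝 u₀, u ≠ u₀ → u ∈ puncturedPlane τ z := by
      simpa [eventually_nhdsWithin_iff] using
        eventually_mem_puncturedPlane (τ := τ) (z := z) u₀
    obtain ⟨U, hU, hUo, hu₀U⟩ := eventually_nhds_iff.1
      (hw.eventually_analyticAt.and (hwK.and (hKd.and (hreg.and hV))))
    refine ⟨U, w, hUo, hu₀U, fun u hu => (hU u hu).1.differentiableAt.differentiableWithinAt,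
      hinj.mono fun u hu => (hU u hu).2.2.2.2, hw0, fun u hu hne v v' => ?_⟩
    obtain ⟨-, h1, h2, h3, -⟩ := hU u hu
    rw [happ u (h3 hne), inner_mul_mul, ← mul_assoc, ← mul_pow, h1, h2, norm_mul, hcn]
    ring

/-! ### Uniqueness -/

/-- Rotating the pair `(1, I)` gives `B 1 I = -B I 1`, so symmetry forces `B 1 I = 0`. -/
lemma eq_smul_innerForm_of_conformal {B : ℂ →L[ℝ] ℂ →L[ℝ] ℝ} (hsymm : ∀ v w, B v w = B w v)
    (hconf : ∀ v w, B (I * v) (I * w) = B v w) : B = B 1 1 • innerForm := by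
  have h1 : B 1 I = 0 := by
    have h := hconf 1 I
    rw [mul_one, I_mul_I, map_neg, hsymm I 1] at h
    linarith
  have h2 : B I I = B 1 1 := by simpa using hconf 1 1
  have h3 : B I 1 = 0 := by rw [hsymm, h1]
  have hdec : ∀ v : ℂ, v = v.re • (1 : ℂ) + v.im • I := fun v => by
    simp [Complex.re_add_im]
  ext v w
  conv_lhs => rw [hdec v, hdec w]
  simp only [map_add, map_smul, add_apply, smul_apply,
    h1, h2, h3, smul_eq_mul, innerForm_apply, Complex.inner]
  simp
  ring

lemma IsFlatConicalMetric.eq_smul_innerForm {g : BilinField τ}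
    (hg : IsFlatConicalMetric τ α (fun i => proj τ (z i)) g) {u : ℂ}
    (hu : u ∈ puncturedPlane τ z) : g (proj τ u) = g (proj τ u) 1 1 • innerForm :=
  eq_smul_innerForm_of_conformal (hg.symm _ hu) (hg.conformal _ hu)

lemma IsFlatConicalMetric.exists_analyticAt_eq {g : BilinField τ}
    (hg : IsFlatConicalMetric τ α (fun i => proj τ (z i)) g) {u₀ : ℂ}
    (hu₀ : u₀ ∈ puncturedPlane τ z) :
    ∃ F : ℂ → ℂ, AnalyticAt ℂ F u₀ ∧ F u₀ ≠ 0 ∧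
      ∀ᶠ u in 𝓝 u₀, g (proj τ u) 1 1 = ‖F u‖ ^ 2 := by
  obtain ⟨U, φ, hU, hu₀U, hφ, h⟩ := hg.flat u₀ hu₀
  refine exists_analyticAt_conformal_factor (hU.inter isOpen_puncturedPlane) ⟨hu₀U, hu₀⟩
    (hφ.mono inter_subset_left) (fun u hu => hg.pos _ hu.2 1 one_ne_zero) fun u hu v w => ?_
  rw [← h u hu.1, hg.eq_smul_innerForm hu.2]
  simp

/-- The coordinate `w` is injective, so `w' u₀ ≠ 0` and `w` is `u - u₀` times a nonvanishing
function `D`; then `|K| = |D|^αᵢ |w'|`. -/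
lemma IsFlatConicalMetric.exists_analyticAt_eq_rpow_mul {g : BilinField τ}
    (hg : IsFlatConicalMetric τ α (fun i => proj τ (z i)) g) {u₀ : ℂ} {i : Fin n}
    (hu₀ : proj τ u₀ = proj τ (z i)) :
    ∃ K : ℂ → ℂ, AnalyticAt ℂ K u₀ ∧ K u₀ ≠ 0 ∧
      ∀ᶠ u in 𝓝[≠] u₀, g (proj τ u) 1 1 = (‖u - u₀‖ ^ α i * ‖K u‖) ^ 2 := by
  obtain ⟨U, w, hU, hu₀U, hwd, hinj, hw0, h⟩ := hg.cone i u₀ hu₀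
  have hw : AnalyticAt ℂ w u₀ := hwd.analyticAt (hU.mem_nhds hu₀U)
  have hw' := deriv_ne_zero_of_injOn hw (hU.mem_nhds hu₀U) hinj
  obtain ⟨P, hP, hP0, hP'⟩ := exists_analyticAt_norm_eq_rpow (analyticAt_dslope hw)
    (by rwa [dslope_same]) (α i)
  refine ⟨fun u => P u * deriv w u, hP.mul hw.deriv, mul_ne_zero hP0 hw', ?_⟩
  filter_upwards [self_mem_nhdsWithin, mem_nhdsWithin_of_mem_nhds (hU.mem_nhds hu₀U),
    hP'.filter_mono nhdsWithin_le_nhds] with u hne hu h2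
  have h3 : w u = (u - u₀) * dslope w u₀ u := by
    have := sub_smul_dslope w u₀ u
    rw [hw0, sub_zero] at this
    exact this.symm
  rw [h u hu hne, inner_mul_mul, norm_mul, h2, ← mul_assoc, ← mul_pow]
  nth_rw 1 [h3]
  rw [norm_mul, Real.mul_rpow (norm_nonneg _) (norm_nonneg _)]
  simp [mul_assoc]

lemma IsFlatConicalMetric.exists_eq_density (hsum : ∑ i, α i = 0)
    (hz : Function.Injective fun i => proj τ (z i)) {g : BilinField τ}
    (hg : IsFlatConicalMetric τ α (fun i => proj τ (z i)) g) :
    ∃ c : ℝ, 0 < c ∧ ∀ u ∈ puncturedPlane τ z,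
      g (proj τ u) = (c * density τ α z u) ^ 2 • innerForm := by
  set G : ℂ → ℝ := fun u => √(g (proj τ u) 1 1) / density τ α z u with hG
  have hreg : ∀ u₀ ∈ puncturedPlane τ z, ∃ F : ℂ → ℂ, AnalyticAt ℂ F u₀ ∧ F u₀ ≠ 0 ∧
      ∀ᶠ u in 𝓝 u₀, G u = ‖F u‖ := fun u₀ hu₀ => by
    obtain ⟨F, hF, hF0, hF'⟩ := hg.exists_analyticAt_eq hu₀
    obtain ⟨D, hD, hD0, hD'⟩ := exists_analyticAt_density_eq (α := α) hu₀
    refine ⟨fun u => F u / D u, hF.div hD hD0, div_ne_zero hF0 hD0, ?_⟩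
    filter_upwards [hF', hD'] with u h1 h2
    rw [hG]
    simp only [h1, h2, norm_div, Real.sqrt_sq (norm_nonneg _)]
  obtain ⟨c, hc, h⟩ := exists_eq_const_of_periodic_of_locally_norm (τ := τ) (G := G)
    (fun l hl u => by simp only [hG, proj_add_of_mem hl, density_add_of_mem hsum hl])
    fun u₀ => by
      by_cases hu₀ : u₀ ∈ puncturedPlane τ z
      · obtain ⟨F, hF, hF0, hF'⟩ := hreg u₀ hu₀
        exact ⟨F, hF, hF0, hF'.filter_mono nhdsWithin_le_nhds⟩
      · obtain ⟨i, hi⟩ : ∃ i, proj τ (z i) = proj τ u₀ := not_not.1 hu₀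
        obtain ⟨F, hF, hF0, hF'⟩ := hg.exists_analyticAt_eq_rpow_mul hi.symm
        obtain ⟨D, hD, hD0, hD'⟩ := exists_analyticAt_density_eq_rpow_mul (α := α) hz hi.symm
        refine ⟨fun u => F u / D u, hF.div hD hD0, div_ne_zero hF0 hD0, ?_⟩
        filter_upwards [self_mem_nhdsWithin, hF', hD'.filter_mono nhdsWithin_le_nhds]
          with u hne h1 h2
        -- Both metrics have the same exponent at the cone, so the singular factors cancel in `G`.
        have hpos : 0 < ‖u - u₀‖ ^ α i :=
          Real.rpow_pos_of_pos (norm_pos_iff.2 (sub_ne_zero.2 hne)) _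
        rw [hG]
        simp only [h1, h2, norm_div]
        rw [Real.sqrt_sq (by positivity), mul_div_mul_left _ _ hpos.ne']
  refine ⟨c, hc, fun u hu => ?_⟩
  obtain ⟨F, hF, hF0, hF'⟩ := hreg u hu
  have hcont : ContinuousAt G u :=
    hF.continuousAt.norm.congr (hF'.mono fun _ h => h.symm)
  have h1 : √(g (proj τ u) 1 1) = c * density τ α z u :=
    (div_eq_iff (density_pos hu).ne').1 (h u hcont)
  rw [hg.eq_smul_innerForm hu, ← h1, Real.sq_sqrt (hg.pos _ hu 1 one_ne_zero).le]

/-! ### Monodromy -/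

/-- Periodicity of the density gives the holomorphic ratio `T₂ (u + l) / T₁ u` modulus one, and the
maximum principle makes it constant. -/
lemma exists_const_of_isDetermination (hsum : ∑ i, α i = 0) {U : Set ℂ} {l : ℂ} {T₁ T₂ : ℂ → ℂ}
    (hU : IsOpen U) (hUc : IsPreconnected U) (hl : l ∈ lattice τ)
    (h₁ : IsDetermination τ α z U T₁) (h₂ : IsDetermination τ α z {u | u - l ∈ U} T₂) :
    ∃ χ : ℂ, ‖χ‖ = 1 ∧ ∀ u ∈ U, T₂ (u + l) = χ * T₁ u := by
  rcases U.eq_empty_or_nonempty with rfl | ⟨p, hp⟩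
  · exact ⟨1, by simp, by simp⟩
  have hmem : ∀ u ∈ U, u + l ∈ {u | u - l ∈ U} := fun u hu => by simpa using hu
  have hnorm : ∀ u ∈ U, ‖T₂ (u + l) / T₁ u‖ = 1 := fun u hu => by
    rw [norm_div, h₂.norm_eq (hmem u hu), density_add_of_mem hsum hl, ← h₁.norm_eq hu,
      div_self (norm_ne_zero_iff.2 (h₁.ne_zero hu))]
  have hd : DifferentiableOn ℂ (fun u => T₂ (u + l) / T₁ u) U :=
    (h₂.differentiableOn.comp (differentiableOn_id.add_const l) hmem).div h₁.differentiableOn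
      fun u hu => h₁.ne_zero hu
  have hconst := Complex.eqOn_of_isPreconnected_of_isMaxOn_norm hUc hU hd hp fun u hu => by
    simp only [Function.comp, mem_ofPred_eq, hnorm u hu, hnorm p hp, le_refl]
  refine ⟨T₂ (p + l) / T₁ p, hnorm p hp, fun u hu => ?_⟩
  have := hconst hu
  simp only [Function.const_apply] at this
  rw [← this, div_mul_cancel₀ _ (h₁.ne_zero hu)]

end FlatTorus

end

theorem propositionP (τ : UpperHalfPlane) (n : ℕ) (α : Fin n → ℝ) (z : Fin n → ℂ)
    (hα : ∀ i, -1 < α i) (hsum : ∑ i, α i = 0)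
    (hz : Function.Injective (fun i => FlatTorus.proj τ (z i))) :
    -- `T` is a multivalued holomorphic function on the punctured curve: it has local determinations
    (∀ u₀ : ℂ, FlatTorus.proj τ u₀ ∉ Set.range (fun i => FlatTorus.proj τ (z i)) →
      ∃ (U : Set ℂ) (T : ℂ → ℂ), IsOpen U ∧ u₀ ∈ U ∧ FlatTorus.IsDetermination τ α z U T) ∧
    -- any two determinations over the same connected open subset of the curve
    -- differ by a constant of modulus one
    (∀ (U : Set ℂ) (l : ℂ) (T₁ T₂ : ℂ → ℂ), IsOpen U → IsPreconnected U →
      l ∈ FlatTorus.lattice τ →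
      FlatTorus.IsDetermination τ α z U T₁ →
      FlatTorus.IsDetermination τ α z {u | u - l ∈ U} T₂ →
      ∃ χ : ℂ, ‖χ‖ = 1 ∧ ∀ u ∈ U, T₂ (u + l) = χ * T₁ u) ∧
    -- the metric `|T(u) du|²` is well defined, is a flat metric of the required type,
    -- and it is the only one up to a positive constant factor
    ∃ m : FlatTorus.BilinField τ,
      (∀ (U : Set ℂ) (T : ℂ → ℂ), IsOpen U → FlatTorus.IsDetermination τ α z U T →
        ∀ u ∈ U, ∀ v w : ℂ, m (FlatTorus.proj τ u) v w = ‖T u‖ ^ 2 * inner ℝ v w) ∧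
      FlatTorus.IsFlatConicalMetric τ α (fun i => FlatTorus.proj τ (z i)) m ∧
      ∀ g : FlatTorus.BilinField τ,
        FlatTorus.IsFlatConicalMetric τ α (fun i => FlatTorus.proj τ (z i)) g ↔
          ∃ c : ℝ, 0 < c ∧ ∀ q, q ∉ Set.range (fun i => FlatTorus.proj τ (z i)) →
            g q = c • m q := by

  refine ⟨fun u₀ hu₀ => FlatTorus.exists_isDetermination α hu₀,
    fun U l T₁ T₂ hU hUc hl h₁ h₂ =>
      FlatTorus.exists_const_of_isDetermination hsum hU hUc hl h₁ h₂,
    FlatTorus.metric τ α z, fun U T _ hT u hu v w => ?_, ?_, fun g => ⟨fun hg => ?_, ?_⟩⟩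
  · rw [FlatTorus.metric_proj hsum, ← hT.norm_eq hu]
    rfl
  · refine FlatTorus.isFlatConicalMetric_of_forall_eq hα hz one_pos fun u _ => ?_
    rw [FlatTorus.metric_proj hsum, one_mul]
  · obtain ⟨c, hc, h⟩ := hg.exists_eq_density hsum hz
    refine ⟨c ^ 2, by positivity, fun q hq => ?_⟩
    obtain ⟨u, rfl⟩ := FlatTorus.proj_surjective q
    rw [h u hq, FlatTorus.metric_proj hsum, mul_pow, mul_smul]
  · rintro ⟨c, hc, h⟩
    -- Scaling the metric by `c` scales its density by `√c`.
    refine FlatTorus.isFlatConicalMetric_of_forall_eq hα hz (Real.sqrt_pos.2 hc) fun u hu => ?_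
    rw [h _ hu, FlatTorus.metric_proj hsum, mul_pow, Real.sq_sqrt hc.le, mul_smul]
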